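/- For $q\in\mathbb R^3$ write $q_0=\sqrt{1+|q|^2}$, and for $\beta>0$ let $M(\beta)=\int_{\mathbb R^3}e^{-\beta p_0}\,dp$ and $K_i(\beta)=\int_0^\infty\cosh(ir)e^{-\beta\cosh r}\,dr$ $(i=1,2)$. For a non-negative $h\in L^1(\mathbb R^3)$ that is not a.e. zero, define $n>0$, $u\in\mathbb R^3$ and $\beta>0$ by $$n^2=\Big(\int h\,dq\Big)^2-\sum_{i=1}^3\Big(\int h\frac{q_i}{q_0}dq\Big)^2,\qquad nu=\int h\frac{q}{q_0}dq,\qquad \frac{K_1}{K_2}(\beta)=\frac1n\int h\frac{1}{q_0}dq,$$ and let $J_h(q)=\frac{n}{M(\beta)}e^{-\beta(\sqrt{1+|u|^2}\sqrt{1+|q|^2}-u\cdot q)}$. Given inflow data $f_L,f_R$ and $w>0$, a mild solution of the stationary Marle-type relativistic BGK boundary value problem $$q_1\partial_xf=w(J_f-f)\ \text{ on }[0,1]\times\mathbb R^3,\qquad f(0,q)=f_L(q)\ (q_1>0),\quad f(1,q)=f_R(q)\ (q_1<0)$$ is a non-negative $f\in L^1([0,1]\times\mathbb R^3)$ such that for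 a.e. $x\in[0,1]$ the slice $f(x,\cdot)$ has well-defined fields $n,u,\beta$ as above, and, for a.e. $q$, $$\begin{aligned}f(x,q)&=\Big(e^{-\frac{w}{|q_1|}x}f_L(q)+\frac{w}{|q_1|}\int_0^xe^{-\frac{w}{|q_1|}(x-y)}J_{f(y,\cdot)}(q)\,dy\Big)1_{q_1>0}\\&\quad+\Big(e^{-\frac{w}{|q_1|}(1-x)}f_R(q)+\frac{w}{|q_1|}\int_x^1e^{-\frac{w}{|q_1|}(y-x)}J_{f(y,\cdot)}(q)\,dy\Big)1_{q_1<0}.\end{aligned}$$ Set $f_{LR}=f_L1_{q_1>0}+f_R1_{q_1<0}$, $f^e_{LR}(x,q)=e^{-\frac{w}{|q_1|}x}f_L1_{q_1>0}+e^{-\frac{w}{|q_1|}(1-x)}f_R1_{q_1<0}$, and $$a_l=\int e^{-\frac{w}{|q_1|}}f_{LR}\frac{1}{q_0^2}dq,\qquad a_u=2\int f_{LR}\,dq,\qquad \lambda(x)=\Big(\int f^e_{LR}\frac1{q_0}dq\Big)\Big(\int f^e_{LR}dq\int f^e_{LR}\frac1{q_0^2}dq\Big)^{-1/2}.$$ **Theorem.**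 Suppose $f_{LR}\ge0$ a.e., $f_{LR}\in L^1(\mathbb R^3)$, and $a_l>0$ for some (equivalently, every) $w>0$. Then there is $\varepsilon>0$, depending only on $f_L,f_R$, such that for every $0<w<\varepsilon$ there is a mild solution $f$ satisfying $$\int f(x,q)\frac1{q_0^2}dq\ge a_l,\qquad \int f(x,q)\,dq\le a_u,\qquad \frac{K_1}{K_2}(\beta(x))\le\sqrt{\lambda(x)}\qquad(*)$$ and $f$ is the only one: every mild solution that satisfies $(*)$ for a.e. $x\in[0,1]$ equals $f$ a.e. on $[0,1]\times\mathbb R^3$. Moreover, a representative of $f$ can be chosen for which the mild formula (for a.e. $q$) and $(*)$ hold for every $x\in[0,1]$. -/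

import Mathlib

open MeasureTheory Set

noncomputable section

namespace MarleBGK

/-- Momentum space `ℝ³`; the coordinates `q₁, q₂, q₃` are `q 0, q 1, q 2`. -/
abbrev Momentum : Type := EuclideanSpace ℝ (Fin 3)

/-- `q₀ = √(1 + |q|²)`. -/
def q0 (q : Momentum) : ℝ := √(1 + ‖q‖ ^ 2)

/-- Modified Bessel function of the second kind,
`K_i(β) = ∫₀^∞ cosh(i r) e^{-β cosh r} dr`. -/
def besselK (i : ℕ) (β : ℝ) : ℝ :=
  ∫ r in Ioi (0 : ℝ), Real.cosh (i * r) * Real.exp (-β * Real.cosh r)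

/-- `(K₁/K₂)(β)`. -/
def besselRatio (β : ℝ) : ℝ := besselK 1 β / besselK 2 β

/-- `M(β) = ∫ e^{-β √(1+|p|²)} dp`. -/
def maxwellianMass (β : ℝ) : ℝ := ∫ p : Momentum, Real.exp (-β * q0 p)

/-- The vector `∫ h q/q₀ dq`, given by its components. -/
def flux (h : Momentum → ℝ) : Momentum :=
  WithLp.toLp 2 fun i => ∫ q : Momentum, h q * (q i / q0 q)

/-- Proper particle density: the root `n ≥ 0` of
`n² = (∫ h dq)² - ∑ᵢ (∫ h qᵢ/q₀ dq)²`. -/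
def density (h : Momentum → ℝ) : ℝ :=
  √((∫ q : Momentum, h q) ^ 2 - ∑ i, (flux h i) ^ 2)

/-- The spatial part `u` of the velocity four-vector: `n u = ∫ h q/q₀ dq`. -/
def velocity (h : Momentum → ℝ) : Momentum := (density h)⁻¹ • flux h

/-- `(1/n) ∫ h/q₀ dq`. -/
def ratioMoment (h : Momentum → ℝ) : ℝ :=
  1 / density h * ∫ q : Momentum, h q * (1 / q0 q)

/-- Inverse equilibrium temperature: the `β > 0` with `(K₁/K₂)(β) = (1/n) ∫ h/q₀ dq`. -/
def invTemp (h : Momentum → ℝ) : ℝ :=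
  Function.invFunOn besselRatio (Ioi 0) (ratioMoment h)

/-- The macroscopic fields of `h` are well defined: `n > 0`, and the equation for `β` has a
solution `β > 0`. -/
def HasMacroFields (h : Momentum → ℝ) : Prop :=
  0 < density h ∧ ∃ β : ℝ, 0 < β ∧ besselRatio β = ratioMoment h

/-- The local relativistic Maxwellian
`J_h(q) = n / M(β) * exp (-β (√(1+|u|²) √(1+|q|²) - u · q))`. -/
def maxwellian (h : Momentum → ℝ) (q : Momentum) : ℝ :=
  density h / maxwellianMass (invTemp h) *
    Real.exp (-invTemp h *
      (√(1 + ‖velocity h‖ ^ 2) * √(1 + ‖q‖ ^ 2) - inner ℝ (velocity h) q))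

/-- `f_{LR} = f_L 1_{q₁>0} + f_R 1_{q₁<0}`. -/
def inflow (fL fR : Momentum → ℝ) (q : Momentum) : ℝ :=
  if 0 < q 0 then fL q else if q 0 < 0 then fR q else 0

/-- `f^e_{LR} = e^{-w x/|q₁|} f_L 1_{q₁>0} + e^{-w (1-x)/|q₁|} f_R 1_{q₁<0}`. -/
def inflowDamped (w : ℝ) (fL fR : Momentum → ℝ) (x : ℝ) (q : Momentum) : ℝ :=
  if 0 < q 0 then Real.exp (-(w / |q 0|) * x) * fL q
  else if q 0 < 0 then Real.exp (-(w / |q 0|) * (1 - x)) * fR q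
  else 0

/-- `a_l = ∫ e^{-w/|q₁|} f_{LR} / q₀² dq`. -/
def aLower (w : ℝ) (fL fR : Momentum → ℝ) : ℝ :=
  ∫ q : Momentum, Real.exp (-(w / |q 0|)) * inflow fL fR q * (1 / q0 q ^ 2)

/-- `a_u = 2 ∫ f_{LR} dq`. -/
def aUpper (fL fR : Momentum → ℝ) : ℝ := 2 * ∫ q : Momentum, inflow fL fR q

/-- `λ = (∫ f^e_{LR}/q₀ dq) (∫ f^e_{LR} dq ∫ f^e_{LR}/q₀² dq)^{-1/2}`, a function of the
position `x`. -/
def lam (w : ℝ) (fL fR : Momentum → ℝ) (x : ℝ) : ℝ :=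
  (∫ q : Momentum, inflowDamped w fL fR x q * (1 / q0 q)) /
    √((∫ q : Momentum, inflowDamped w fL fR x q) *
      ∫ q : Momentum, inflowDamped w fL fR x q * (1 / q0 q ^ 2))

/-- The right-hand side of the mild formulation, for the unknown `f x q`. -/
def mildRHS (w : ℝ) (fL fR : Momentum → ℝ) (f : ℝ → Momentum → ℝ) (x : ℝ)
    (q : Momentum) : ℝ :=
  if 0 < q 0 then
    Real.exp (-(w / |q 0|) * x) * fL q +
      w / |q 0| * ∫ y in (0 : ℝ)..x, Real.exp (-(w / |q 0|) * (x - y)) * maxwellian (f y) q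
  else if q 0 < 0 then
    Real.exp (-(w / |q 0|) * (1 - x)) * fR q +
      w / |q 0| * ∫ y in x..(1 : ℝ), Real.exp (-(w / |q 0|) * (y - x)) * maxwellian (f y) q
  else 0

/-- At the position `x`, the slice `f x` is a non-negative element of `L¹(ℝ³)` whose macroscopic
fields are well defined, and the mild formulation holds for almost every `q`. -/
structure IsMildAt (w : ℝ) (fL fR : Momentum → ℝ) (f : ℝ → Momentum → ℝ) (x : ℝ) : Prop where
  integrable : Integrable (f x)
  nonneg : ∀ᵐ q : Momentum, 0 ≤ f x q
  fields : HasMacroFields (f x)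
  eq_mild : ∀ᵐ q : Momentum, f x q = mildRHS w fL fR f x q

/-- Lebesgue measure on the slab `[0,1] × ℝ³`. -/
def slab : Measure (ℝ × Momentum) := (volume.restrict (Icc (0 : ℝ) 1)).prod volume

/-- `f ∈ L¹([0,1] × ℝ³)` is a mild solution; as usual for `L¹` functions, everything is required
for almost every `x ∈ [0,1]` and almost every `q`. -/
structure IsMildSolution (w : ℝ) (fL fR : Momentum → ℝ) (f : ℝ → Momentum → ℝ) : Prop where
  integrable : Integrable (Function.uncurry f) slab
  mild : ∀ᵐ x ∂volume.restrict (Icc (0 : ℝ) 1), IsMildAt w fL fR f x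

/-- The three bounds
`∫ f/q₀² dq ≥ a_l`, `∫ f dq ≤ a_u`, `(K₁/K₂)(β) ≤ √λ` at the position `x`. -/
structure BoundsAt (w : ℝ) (fL fR : Momentum → ℝ) (f : ℝ → Momentum → ℝ) (x : ℝ) : Prop where
  lower : aLower w fL fR ≤ ∫ q : Momentum, f x q * (1 / q0 q ^ 2)
  upper : ∫ q : Momentum, f x q ≤ aUpper fL fR
  ratio : besselRatio (invTemp (f x)) ≤ √(lam w fL fR x)

end MarleBGK

end

noncomputable section

namespace MarleBGK

open Filter Topology

/-! ### Cauchy–Schwarz for weighted integrals -/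

section CauchySchwarz

variable {α : Type*} [MeasurableSpace α] {μ : Measure α}

/-! The Maxwellian `J_h` depends on `h` only through the moments `ρ = ∫ h`, `F = ∫ h q/q₀`, `S = ∫
h/q₀`. So the mild equation is a fixed-point equation for a function `x ↦ m(x)` of moments: insert
`m` into the gain term, add the damped inflow, take moments again (`momentMap`). This map is a
contraction, for the uniform distance, of the measurable functions with values in a closed set
`momentSet a A c`.

On that set `S/n` lies in `[a/A, c]`, a compact subset of `(0,1)`. By Cauchy–Schwarz, `K₁/K₂` has
positive derivative, and it maps `(0,∞)` onto `(0,1)`; hence `β` stays in a compact subset of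
`(0,∞)` and is Lipschitz in the moments. The exponent of the Maxwellian is bounded below by a fixed
multiple of `q₀`, so the Maxwellian is bounded by `C e^{-b q₀}` and Lipschitz with a constant of the
same form (`exists_gibbs_bounds`). The transport kernel has mass at most `1 - e^{-w/|q₁|}`, and by
dominated convergence the gain and its Lipschitz constant are at most `κ(w) → 0` in `L¹`
(`tendsto_integral_gainBound`).

The delicate point is invariance of the bound on `S/n` (`profile_bounds`). With `N = √(∫ f^e_{LR} ∫
f^e_{LR}/q₀²)`, Cauchy–Schwarz gives `n ≥ N`, while `S ≤ λN + κ`. Strict Cauchy–Schwarz keeps `λ`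
away from `1` uniformly in `x` for small `w`, so `√λ` exceeds `λ` by enough to absorb `κ`.

For uniqueness, `(*)` puts the moments of any competitor in the same set at almost every `x`;
applying the moment map once removes the exceptional null set and gives an exact fixed point. -/

lemma integral_mul_sub_sq {h a : α → ℝ} (h0 : Integrable h μ)
    (h1 : Integrable (fun x => h x * a x) μ) (h2 : Integrable (fun x => h x * a x ^ 2) μ) (t : ℝ) :
    ∫ x, h x * (a x - t) ^ 2 ∂μ =
      ∫ x, h x * a x ^ 2 ∂μ - 2 * t * ∫ x, h x * a x ∂μ + t ^ 2 * ∫ x, h x ∂μ := by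
  have h3 : Integrable (fun x => h x * a x ^ 2 - 2 * t * (h x * a x)) μ :=
    h2.sub (h1.const_mul _)
  rw [← integral_const_mul, ← integral_const_mul, ← integral_sub h2 (h1.const_mul _),
    ← integral_add h3 (h0.const_mul _)]
  congr 1
  ext x
  ring

/-- The quadratic `t ↦ ∫ h (a - t)²` is non-negative, so its discriminant is at most zero. -/
lemma sq_integral_mul_le {h a : α → ℝ} (hn : 0 ≤ᵐ[μ] h) (h0 : Integrable h μ)
    (h1 : Integrable (fun x => h x * a x) μ) (h2 : Integrable (fun x => h x * a x ^ 2) μ) :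
    (∫ x, h x * a x ∂μ) ^ 2 ≤ (∫ x, h x ∂μ) * ∫ x, h x * a x ^ 2 ∂μ := by
  have key : ∀ t : ℝ, 0 ≤ (∫ x, h x ∂μ) * (t * t) + (-2 * ∫ x, h x * a x ∂μ) * t
      + ∫ x, h x * a x ^ 2 ∂μ := by
    intro t
    have h3 : 0 ≤ ∫ x, h x * (a x - t) ^ 2 ∂μ := by
      apply integral_nonneg_of_ae
      filter_upwards [hn] with x hx
      exact mul_nonneg hx (sq_nonneg _)
    rw [integral_mul_sub_sq h0 h1 h2] at h3
    linarith
  have := discrim_le_zero key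
  rw [discrim] at this
  nlinarith

/-- At the weighted mean `t = ∫ h a / ∫ h` the quadratic is the unnormalised variance, which
vanishes only if `a` is constant where `h ≠ 0`; multiplying by `∫ h` gives the strict inequality. -/
lemma sq_integral_mul_lt {h a : α → ℝ} (hn : 0 ≤ᵐ[μ] h) (h0 : Integrable h μ)
    (h1 : Integrable (fun x => h x * a x) μ) (h2 : Integrable (fun x => h x * a x ^ 2) μ)
    (hpos : 0 < ∫ x, h x ∂μ) (hne : ∀ t : ℝ, ¬ ∀ᵐ x ∂μ, h x * (a x - t) ^ 2 = 0) :
    (∫ x, h x * a x ∂μ) ^ 2 < (∫ x, h x ∂μ) * ∫ x, h x * a x ^ 2 ∂μ := by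
  set t := (∫ x, h x * a x ∂μ) / ∫ x, h x ∂μ with ht
  have hnn : 0 ≤ᵐ[μ] fun x => h x * (a x - t) ^ 2 := by
    filter_upwards [hn] with x hx
    exact mul_nonneg hx (sq_nonneg _)
  have hint : Integrable (fun x => h x * (a x - t) ^ 2) μ := by
    refine ((h2.sub (h1.const_mul (2 * t))).add (h0.const_mul (t ^ 2))).congr (.of_forall ?_)
    intro x
    simp only [Pi.add_apply, Pi.sub_apply]
    ring
  have h3 : 0 < ∫ x, h x * (a x - t) ^ 2 ∂μ := by
    refine lt_of_le_of_ne (integral_nonneg_of_ae hnn) fun h4 => hne t ?_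
    exact (integral_eq_zero_iff_of_nonneg_ae hnn hint).1 h4.symm
  rw [integral_mul_sub_sq h0 h1 h2] at h3
  have h5 : t * ∫ x, h x ∂μ = ∫ x, h x * a x ∂μ := by
    rw [ht]; field_simp
  nlinarith [mul_pos hpos h3]

end CauchySchwarz

/-! ### The function `K₁ / K₂` -/

/-- `∫₀^∞ cosh(r)^k e^{-β cosh r} dr`. -/
def coshMoment (k : ℕ) (β : ℝ) : ℝ :=
  ∫ r in Ioi (0 : ℝ), Real.cosh r ^ k * Real.exp (-β * Real.cosh r)

/-- Half of the decay rate pays for the power: `s ^ k / k! ≤ e^s` at `s = b t / 2`. -/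
lemma pow_mul_exp_neg_le (k : ℕ) {b t : ℝ} (hb : 0 < b) (ht : 0 ≤ t) :
    t ^ k * Real.exp (-b * t) ≤ (k.factorial * (2 / b) ^ k) * Real.exp (-(b / 2) * t) := by
  have h1 : (b / 2 * t) ^ k / k.factorial ≤ Real.exp (b / 2 * t) :=
    Real.pow_div_factorial_le_exp _ (by positivity) k
  have h2 : t ^ k ≤ (k.factorial * (2 / b) ^ k) * Real.exp (b / 2 * t) := by
    have h3 : t ^ k = (k.factorial * (2 / b) ^ k) * ((b / 2 * t) ^ k / k.factorial) := by
      rw [mul_pow, div_pow, div_pow]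
      field_simp
    rw [h3]
    gcongr
  calc t ^ k * Real.exp (-b * t)
      ≤ ((k.factorial * (2 / b) ^ k) * Real.exp (b / 2 * t)) * Real.exp (-b * t) := by gcongr
    _ = _ := by rw [mul_assoc, ← Real.exp_add]; congr 2; ring

lemma exp_neg_mul_cosh_le {b r : ℝ} (hb : 0 ≤ b) (hr : 0 ≤ r) :
    Real.exp (-b * Real.cosh r) ≤ Real.exp (-b * r) := by
  have h1 : r ≤ Real.cosh r := (Real.self_le_sinh_iff.2 hr).trans (Real.sinh_lt_cosh r).le
  apply Real.exp_le_exp.2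
  nlinarith

lemma cosh_pow_mul_exp_le (k : ℕ) {b β r : ℝ} (hb : 0 < b) (hβ : b ≤ β) (hr : 0 ≤ r) :
    Real.cosh r ^ k * Real.exp (-β * Real.cosh r) ≤
      (k.factorial * (2 / b) ^ k) * Real.exp (-(b / 2) * r) := by
  have hc := Real.cosh_pos r
  calc Real.cosh r ^ k * Real.exp (-β * Real.cosh r)
      ≤ Real.cosh r ^ k * Real.exp (-b * Real.cosh r) := by
        gcongr
    _ ≤ (k.factorial * (2 / b) ^ k) * Real.exp (-(b / 2) * Real.cosh r) :=
        pow_mul_exp_neg_le k hb hc.le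
    _ ≤ _ := by
        gcongr ?_ * ?_
        exact exp_neg_mul_cosh_le (by positivity) hr

lemma integrableOn_exp_bound (C : ℝ) {b : ℝ} (hb : 0 < b) :
    Integrable (fun r => C * Real.exp (-(b / 2) * r)) (volume.restrict (Ioi (0 : ℝ))) :=
  (exp_neg_integrableOn_Ioi 0 (half_pos hb)).const_mul C

lemma integrable_coshMoment (k : ℕ) {β : ℝ} (hβ : 0 < β) :
    Integrable (fun r => Real.cosh r ^ k * Real.exp (-β * Real.cosh r))
      (volume.restrict (Ioi (0 : ℝ))) := by
  refine (integrableOn_exp_bound (k.factorial * (2 / β) ^ k) hβ).mono'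
    (Continuous.aestronglyMeasurable (by fun_prop)) ?_
  filter_upwards [ae_restrict_mem measurableSet_Ioi] with r hr
  rw [Real.norm_of_nonneg (by have := Real.cosh_pos r; positivity)]
  exact cosh_pow_mul_exp_le k hβ le_rfl (le_of_lt hr)

lemma coshMoment_pos (k : ℕ) {β : ℝ} (hβ : 0 < β) : 0 < coshMoment k β := by
  have hpos : ∀ r, 0 < Real.cosh r ^ k * Real.exp (-β * Real.cosh r) := fun r => by
    have := Real.cosh_pos r
    positivity
  rw [coshMoment, integral_pos_iff_support_of_nonneg (fun r => (hpos r).le)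
    (integrable_coshMoment k hβ)]
  have : Function.support (fun r => Real.cosh r ^ k * Real.exp (-β * Real.cosh r)) = univ := by
    ext r; simpa using (hpos r).ne'
  rw [this]
  simp

/-- Differentiation under the integral: for parameters above `β / 2` the differentiated integrand
has one integrable majorant. -/
lemma hasDerivAt_coshMoment (k : ℕ) {β : ℝ} (hβ : 0 < β) :
    HasDerivAt (coshMoment k) (-coshMoment (k + 1) β) β := by
  have h := hasDerivAt_integral_of_dominated_loc_of_deriv_le (μ := volume.restrict (Ioi (0 : ℝ)))
    (F := fun β r => Real.cosh r ^ k * Real.exp (-β * Real.cosh r))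
    (F' := fun β r => -(Real.cosh r ^ (k + 1) * Real.exp (-β * Real.cosh r)))
    (x₀ := β) (s := Ioi (β / 2))
    (bound := fun r => ((k + 1).factorial * (2 / (β / 2)) ^ (k + 1)) *
      Real.exp (-(β / 2 / 2) * r)) (Ioi_mem_nhds (by linarith))
    (.of_forall fun β => Continuous.aestronglyMeasurable (by fun_prop))
    (integrable_coshMoment k hβ) (Continuous.aestronglyMeasurable (by fun_prop)) ?_
    (integrableOn_exp_bound _ (half_pos hβ)) ?_
  · have h2 := h.2
    rw [integral_neg] at h2
    exact h2
  · filter_upwards [ae_restrict_mem measurableSet_Ioi] with r hr x hx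
    rw [norm_neg, Real.norm_of_nonneg (by have := Real.cosh_pos r; positivity)]
    exact cosh_pow_mul_exp_le _ (half_pos hβ) (le_of_lt hx) (le_of_lt hr)
  · refine .of_forall fun r x _ => ?_
    have h1 : HasDerivAt (fun x : ℝ => -x * Real.cosh r) (-1 * Real.cosh r) x :=
      (hasDerivAt_id x).neg.mul_const _
    exact (h1.exp.const_mul (Real.cosh r ^ k)).congr_deriv (by ring)

/-- Integrate the derivative of `sinh r e^{-β cosh r}` over `(0,∞)`; both boundary terms vanish and
`sinh² = cosh² - 1`. This is the Bessel recurrence `K₂ - K₀ = (2/β) K₁`. -/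
lemma coshMoment_sub {β : ℝ} (hβ : 0 < β) :
    β * (coshMoment 2 β - coshMoment 0 β) = coshMoment 1 β := by
  have hi := integrable_coshMoment 1 hβ
  have hi2 : Integrable (fun r => β * (Real.cosh r ^ 2 * Real.exp (-β * Real.cosh r) -
      Real.cosh r ^ 0 * Real.exp (-β * Real.cosh r))) (volume.restrict (Ioi (0 : ℝ))) :=
    ((integrable_coshMoment 2 hβ).sub (integrable_coshMoment 0 hβ)).const_mul β
  have hi3 : IntegrableOn (fun r => Real.cosh r ^ 1 * Real.exp (-β * Real.cosh r) -
      β * (Real.cosh r ^ 2 * Real.exp (-β * Real.cosh r) -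
        Real.cosh r ^ 0 * Real.exp (-β * Real.cosh r))) (Ioi 0) := hi.sub hi2
  have h := integral_Ioi_of_hasDerivAt_of_tendsto' (a := (0 : ℝ)) (m := 0)
    (f := fun r => Real.sinh r * Real.exp (-β * Real.cosh r))
    (f' := fun r => Real.cosh r ^ 1 * Real.exp (-β * Real.cosh r) -
      β * (Real.cosh r ^ 2 * Real.exp (-β * Real.cosh r) -
        Real.cosh r ^ 0 * Real.exp (-β * Real.cosh r))) ?_ hi3 ?_
  · rw [integral_sub hi hi2, integral_const_mul,
      integral_sub (integrable_coshMoment 2 hβ) (integrable_coshMoment 0 hβ)] at h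
    simp only [Real.sinh_zero, zero_mul, sub_zero] at h
    simp only [coshMoment]
    linarith
  · intro r _
    have h1 : HasDerivAt (fun r : ℝ => -β * Real.cosh r) (-β * Real.sinh r) r :=
      (Real.hasDerivAt_cosh r).const_mul _
    refine ((Real.hasDerivAt_sinh r).mul h1.exp).congr_deriv ?_
    linear_combination (β * Real.exp (-β * Real.cosh r)) * Real.cosh_sq r
  · have h0 : Tendsto (fun r : ℝ => (Nat.factorial 1 * (2 / β) ^ 1) * Real.exp (-(β / 2) * r)) atTop
        (𝓝 0) := by
      have : Tendsto (fun r : ℝ => -(β / 2) * r) atTop atBot :=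
        tendsto_id.const_mul_atTop_of_neg (by linarith)
      have h := (Real.tendsto_exp_atBot.comp this).const_mul (Nat.factorial 1 * (2 / β) ^ 1)
      rwa [mul_zero] at h
    refine squeeze_zero' ?_ ?_ h0
    · filter_upwards [eventually_ge_atTop 0] with r hr
      have := Real.sinh_nonneg_iff.2 hr
      positivity
    · filter_upwards [eventually_ge_atTop 0] with r hr
      refine le_trans ?_ (cosh_pow_mul_exp_le 1 hβ le_rfl hr)
      rw [pow_one]
      gcongr
      exact (Real.sinh_lt_cosh r).le

lemma besselK_one (β : ℝ) : besselK 1 β = coshMoment 1 β := by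
  simp [besselK, coshMoment]

lemma besselK_two {β : ℝ} (hβ : 0 < β) :
    besselK 2 β = 2 * coshMoment 2 β - coshMoment 0 β := by
  rw [besselK, coshMoment, coshMoment, ← integral_const_mul,
    ← integral_sub ((integrable_coshMoment 2 hβ).const_mul 2) (integrable_coshMoment 0 hβ)]
  congr 1
  ext r
  push_cast
  rw [Real.cosh_two_mul, Real.sinh_sq]
  ring

lemma besselK_two_eq {β : ℝ} (hβ : 0 < β) :
    besselK 2 β = coshMoment 0 β + 2 / β * coshMoment 1 β := by
  rw [besselK_two hβ, ← coshMoment_sub hβ]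
  field_simp
  ring

lemma besselK_two_pos {β : ℝ} (hβ : 0 < β) : 0 < besselK 2 β := by
  rw [besselK_two_eq hβ]
  have := coshMoment_pos 0 hβ
  have := coshMoment_pos 1 hβ
  positivity

/-- Dropping `K₀ > 0` from `K₂ = K₀ + (2/β) K₁`. This forces the ratio to `0` as `β → 0`; the
companion lower bound, from `K₀ ≤ K₁`, forces it towards `1` as `β → ∞`. -/
lemma besselRatio_le {β : ℝ} (hβ : 0 < β) : besselRatio β ≤ β / 2 := by
  rw [besselRatio, div_le_iff₀ (besselK_two_pos hβ), besselK_one, besselK_two_eq hβ]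
  have := coshMoment_pos 0 hβ
  have h : β / 2 * (coshMoment 0 β + 2 / β * coshMoment 1 β) =
    β / 2 * coshMoment 0 β + coshMoment 1 β := by field_simp
  rw [h]
  have : 0 < β / 2 * coshMoment 0 β := by positivity
  linarith

lemma coshMoment_zero_le_one {β : ℝ} (hβ : 0 < β) : coshMoment 0 β ≤ coshMoment 1 β := by
  refine integral_mono (integrable_coshMoment 0 hβ) (integrable_coshMoment 1 hβ) fun r => ?_
  have := Real.one_le_cosh r
  simp only [pow_zero, pow_one]
  gcongr

lemma le_besselRatio {β : ℝ} (hβ : 0 < β) : β / (β + 2) ≤ besselRatio β := by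
  rw [besselRatio, div_le_div_iff₀ (by positivity) (besselK_two_pos hβ), besselK_one,
    besselK_two_eq hβ]
  have h : β * (coshMoment 0 β + 2 / β * coshMoment 1 β) =
    β * coshMoment 0 β + 2 * coshMoment 1 β := by field_simp
  rw [h]
  nlinarith [coshMoment_zero_le_one hβ]

/-- The derivative of `K₁ / K₂`. -/
def besselRatioDeriv (β : ℝ) : ℝ :=
  (2 * (coshMoment 1 β * coshMoment 3 β - coshMoment 2 β ^ 2) +
    (coshMoment 0 β * coshMoment 2 β - coshMoment 1 β ^ 2)) /
    (2 * coshMoment 2 β - coshMoment 0 β) ^ 2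

lemma hasDerivAt_besselRatio {β : ℝ} (hβ : 0 < β) :
    HasDerivAt besselRatio (besselRatioDeriv β) β := by
  have hne : 2 * coshMoment 2 β - coshMoment 0 β ≠ 0 := by
    rw [← besselK_two hβ]; exact (besselK_two_pos hβ).ne'
  have h := (hasDerivAt_coshMoment 1 hβ).div
    (((hasDerivAt_coshMoment 2 hβ).const_mul 2).sub (hasDerivAt_coshMoment 0 hβ)) hne
  have h2 : besselRatio =ᶠ[𝓝 β]
      (coshMoment 1 / fun y => 2 * coshMoment 2 y - coshMoment 0 y) := by
    filter_upwards [Ioi_mem_nhds hβ] with y hy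
    rw [besselRatio, besselK_one, besselK_two hy]
    rfl
  refine (h.congr_of_eventuallyEq h2).congr_deriv ?_
  rw [besselRatioDeriv]
  simp only [Pi.sub_apply]
  congr 1
  ring

lemma continuousOn_coshMoment (k : ℕ) : ContinuousOn (coshMoment k) (Ioi 0) := fun _ hβ =>
  (hasDerivAt_coshMoment k hβ).continuousAt.continuousWithinAt

/-- The numerator is a sum of two Cauchy–Schwarz defects for the function `cosh`, with weights `cosh
r e^{-β cosh r}` and `e^{-β cosh r}`; the second is strict. -/
lemma besselRatioDeriv_pos {β : ℝ} (hβ : 0 < β) : 0 < besselRatioDeriv β := by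
  have hI := fun k => integrable_coshMoment k hβ
  have hn : ∀ k, 0 ≤ᵐ[volume.restrict (Ioi (0 : ℝ))]
      fun r => Real.cosh r ^ k * Real.exp (-β * Real.cosh r) := fun k => .of_forall fun r => by
    have := Real.cosh_pos r
    simp only [Pi.zero_apply]
    positivity
  have e : ∀ k j l : ℕ, k + j = l →
      (fun r => Real.cosh r ^ k * Real.exp (-β * Real.cosh r) * Real.cosh r ^ j) =
      fun r => Real.cosh r ^ l * Real.exp (-β * Real.cosh r) := by
    intro k j l h
    ext r
    rw [← h]
    ring
  have e1 : ∀ k l : ℕ, k + 1 = l →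
      (fun r => Real.cosh r ^ k * Real.exp (-β * Real.cosh r) * Real.cosh r) =
      fun r => Real.cosh r ^ l * Real.exp (-β * Real.cosh r) := by
    intro k l h
    simpa using e k 1 l h
  have h1 : coshMoment 2 β ^ 2 ≤ coshMoment 1 β * coshMoment 3 β := by
    have := sq_integral_mul_le (a := Real.cosh) (hn 1) (hI 1) (by rw [e1 1 2 rfl]; exact hI 2)
      (by rw [e 1 2 3 rfl]; exact hI 3)
    rw [e1 1 2 rfl, e 1 2 3 rfl] at this
    exact this
  have h2 : coshMoment 1 β ^ 2 < coshMoment 0 β * coshMoment 2 β := by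
    have := sq_integral_mul_lt (a := Real.cosh) (hn 0) (hI 0) (by rw [e1 0 1 rfl]; exact hI 1)
      (by rw [e 0 2 2 rfl]; exact hI 2) (coshMoment_pos 0 hβ) ?_
    · rw [e1 0 1 rfl, e 0 2 2 rfl] at this
      exact this
    · intro t ht
      -- Equality would make `cosh` almost everywhere constant, hence constant on the open half-line
      -- by continuity; the values at `1` and `2` differ.
      have hc : (fun r => Real.cosh r) =ᵐ[volume.restrict (Ioi (0 : ℝ))] fun _ => t := by
        filter_upwards [ht] with r hr
        have : Real.cosh r - t = 0 := by simpa using hr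
        linarith
      have h3 := (Measure.eqOn_open_of_ae_eq hc isOpen_Ioi Real.continuous_cosh.continuousOn
        continuousOn_const)
      have h4 := h3 (show (1 : ℝ) ∈ Ioi 0 by simp)
      have h5 := h3 (show (2 : ℝ) ∈ Ioi 0 by simp)
      have h6 : Real.cosh 1 < Real.cosh 2 := by
        rw [Real.cosh_lt_cosh]; norm_num
      simp only at h4 h5
      linarith
  have hpos : 0 < 2 * coshMoment 2 β - coshMoment 0 β := by
    rw [← besselK_two hβ]; exact besselK_two_pos hβ
  rw [besselRatioDeriv]
  apply div_pos _ (by positivity)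
  linarith

lemma continuousOn_besselRatioDeriv : ContinuousOn besselRatioDeriv (Ioi 0) := by
  have h := continuousOn_coshMoment
  refine ContinuousOn.div ?_ ?_ ?_
  · exact ((((h 1).mul (h 3)).sub ((h 2).pow 2)).const_mul 2).add
      (((h 0).mul (h 2)).sub ((h 1).pow 2))
  · exact (((h 2).const_mul 2).sub (h 0)).pow 2
  · intro β hβ
    rw [← besselK_two hβ]
    exact pow_ne_zero _ (besselK_two_pos hβ).ne'

lemma strictMonoOn_besselRatio : StrictMonoOn besselRatio (Ioi 0) := by
  apply strictMonoOn_of_deriv_pos (convex_Ioi 0)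
  · exact fun β hβ => (hasDerivAt_besselRatio hβ).continuousAt.continuousWithinAt
  · intro β hβ
    rw [interior_Ioi] at hβ
    rw [(hasDerivAt_besselRatio hβ).deriv]
    exact besselRatioDeriv_pos hβ

/-- Intermediate values between `2r` and `2r/(1-r)`, the points where the bounds `β/2` and `β/(β+2)`
equal `r`. -/
lemma exists_besselRatio_eq {r : ℝ} (h0 : 0 < r) (h1 : r < 1) :
    ∃ β : ℝ, 0 < β ∧ besselRatio β = r := by
  have hb : (0 : ℝ) < 2 * r / (1 - r) := by
    have : 0 < 1 - r := by linarith
    positivity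
  have hle : besselRatio (2 * r) ≤ r := (besselRatio_le (by linarith)).trans (by linarith)
  have hge : r ≤ besselRatio (2 * r / (1 - r)) := by
    refine le_trans (le_of_eq ?_) (le_besselRatio hb)
    have : 1 - r ≠ 0 := by linarith
    field_simp
    ring
  have hcont : ContinuousOn besselRatio (Ioi 0) :=
    fun β hβ => (hasDerivAt_besselRatio hβ).continuousAt.continuousWithinAt
  obtain ⟨β, hβ, h⟩ := isPreconnected_Ioi.intermediate_value (a := 2 * r)
    (show 2 * r ∈ Ioi (0 : ℝ) by simpa using h0) (show 2 * r / (1 - r) ∈ Ioi (0 : ℝ) from hb) hcont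
    ⟨hle, hge⟩
  exact ⟨β, hβ, h⟩

/-- The inverse of `K₁ / K₂`. -/
def besselRatioInv (r : ℝ) : ℝ := Function.invFunOn besselRatio (Ioi 0) r

lemma besselRatioInv_spec {r : ℝ} (h : ∃ β : ℝ, 0 < β ∧ besselRatio β = r) :
    0 < besselRatioInv r ∧ besselRatio (besselRatioInv r) = r :=
  ⟨Function.invFunOn_mem (s := Ioi 0) h, Function.invFunOn_eq (s := Ioi 0) h⟩

/-- On a compact subinterval of `(0, 1)` the inverse of `K₁ / K₂` is Lipschitz, with values in a
compact subinterval of `(0, ∞)`. -/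
lemma exists_besselRatioInv_bounds {r₁ r₂ : ℝ} (h1 : 0 < r₁) (h2 : r₂ < 1) :
    ∃ b₁ b₂ L : ℝ, 0 < b₁ ∧ 0 ≤ L ∧
      (∀ r ∈ Icc r₁ r₂, besselRatioInv r ∈ Icc b₁ b₂) ∧
      ∀ r ∈ Icc r₁ r₂, ∀ s ∈ Icc r₁ r₂, |besselRatioInv r - besselRatioInv s| ≤ L * |r - s| := by
  by_cases h12 : r₁ ≤ r₂
  swap
  · refine ⟨1, 1, 0, one_pos, le_rfl, ?_, ?_⟩ <;>
    · intro r hr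
      exact absurd (hr.1.trans hr.2) h12
  have hspec : ∀ r ∈ Icc r₁ r₂, 0 < besselRatioInv r ∧ besselRatio (besselRatioInv r) = r :=
    fun r hr => besselRatioInv_spec
      (exists_besselRatio_eq (h1.trans_le hr.1) (hr.2.trans_lt h2))
  have s1 := hspec r₁ (left_mem_Icc.2 h12)
  have s2 := hspec r₂ (right_mem_Icc.2 h12)
  set b₁ := besselRatioInv r₁
  set b₂ := besselRatioInv r₂
  have hmem : ∀ r ∈ Icc r₁ r₂, besselRatioInv r ∈ Icc b₁ b₂ := by
    intro r hr
    have s := hspec r hr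
    constructor
    · rw [← strictMonoOn_besselRatio.le_iff_le s1.1 s.1, s1.2, s.2]; exact hr.1
    · rw [← strictMonoOn_besselRatio.le_iff_le s.1 s2.1, s2.2, s.2]; exact hr.2
  have hsub : Icc b₁ b₂ ⊆ Ioi 0 := fun x hx => s1.1.trans_le hx.1
  -- The minimum `k > 0` of the derivative over the compact interval of temperatures is a lower
  -- bound for the slope, so `k⁻¹` is a Lipschitz constant of the inverse.
  obtain ⟨x, hx, hmin⟩ := isCompact_Icc.exists_isMinOn
    (s := Icc b₁ b₂) ⟨b₁, hmem r₁ (left_mem_Icc.2 h12)⟩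
    (continuousOn_besselRatioDeriv.mono hsub)
  have hk := besselRatioDeriv_pos (hsub hx)
  set k := besselRatioDeriv x
  have hslope : ∀ s ∈ Icc b₁ b₂, ∀ t ∈ Icc b₁ b₂, s ≤ t →
      k * (t - s) ≤ besselRatio t - besselRatio s := by
    refine (convex_Icc b₁ b₂).mul_sub_le_image_sub_of_le_deriv
      (fun y hy => (hasDerivAt_besselRatio (hsub hy)).continuousAt.continuousWithinAt)
      (fun y hy => (hasDerivAt_besselRatio
        (hsub (interior_subset hy))).differentiableAt.differentiableWithinAt) ?_
    intro y hy
    rw [(hasDerivAt_besselRatio (hsub (interior_subset hy))).deriv]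
    exact hmin (interior_subset hy)
  refine ⟨b₁, b₂, k⁻¹, s1.1, by positivity, hmem, fun r hr s hs => ?_⟩
  rw [inv_mul_eq_div, le_div_iff₀ hk]
  have sr := hspec r hr
  have ss := hspec s hs
  rcases le_total (besselRatioInv r) (besselRatioInv s) with h | h
  · have := hslope _ (hmem r hr) _ (hmem s hs) h
    rw [sr.2, ss.2] at this
    rw [abs_sub_comm, abs_of_nonneg (sub_nonneg.2 h), abs_sub_comm]
    linarith [le_abs_self (s - r)]
  · have := hslope _ (hmem s hs) _ (hmem r hr) h
    rw [sr.2, ss.2] at this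
    rw [abs_of_nonneg (sub_nonneg.2 h)]
    linarith [le_abs_self (r - s)]

/-! ### Energy and Gibbs factors -/

lemma one_le_q0 (q : Momentum) : 1 ≤ q0 q :=
  Real.one_le_sqrt.2 (by linarith [sq_nonneg ‖q‖])

lemma q0_pos (q : Momentum) : 0 < q0 q := one_pos.trans_le (one_le_q0 q)

lemma q0_sq (q : Momentum) : q0 q ^ 2 = 1 + ‖q‖ ^ 2 := Real.sq_sqrt (by positivity)

lemma norm_le_q0 (q : Momentum) : ‖q‖ ≤ q0 q := Real.le_sqrt_of_sq_le (by linarith)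

lemma abs_apply_le_q0 (q : Momentum) (i : Fin 3) : |q i| ≤ q0 q :=
  (PiLp.norm_apply_le q i).trans (norm_le_q0 q)

@[fun_prop]
lemma continuous_q0 : Continuous q0 := by unfold q0; fun_prop

/-- Comparison with `(1 + ‖q‖)⁻⁴`, integrable in dimension three; the factor `16` comes from `1 +
‖q‖ ≤ 2 q₀`. -/
lemma integrable_exp_neg_q0 {c : ℝ} (hc : 0 < c) :
    Integrable fun q : Momentum => Real.exp (-c * q0 q) := by
  have h4 : Integrable fun q : Momentum => (1 + ‖q‖) ^ (-(4 : ℝ)) :=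
    integrable_one_add_norm (by rw [finrank_euclideanSpace_fin]; norm_num)
  set C : ℝ := Nat.factorial 4 * (2 / c) ^ 4 with hC
  refine (h4.const_mul (16 * C)).mono' (Continuous.aestronglyMeasurable (by fun_prop))
    (.of_forall fun q => ?_)
  rw [Real.norm_of_nonneg (Real.exp_pos _).le, Real.rpow_neg (by positivity)]
  have h1 := pow_mul_exp_neg_le 4 hc (q0_pos q).le
  have h2 : Real.exp (-(c / 2) * q0 q) ≤ 1 :=
    Real.exp_le_one_iff.2 (by have := q0_pos q; nlinarith)
  have h3 : (1 + ‖q‖) ^ 4 ≤ 16 * q0 q ^ 4 := by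
    calc (1 + ‖q‖) ^ 4 ≤ (2 * q0 q) ^ 4 := by
          gcongr
          linarith [norm_le_q0 q, one_le_q0 q]
      _ = 16 * q0 q ^ 4 := by ring
  have h5 : (1 + ‖q‖) ^ (4 : ℝ) = (1 + ‖q‖) ^ 4 := by
    rw [← Real.rpow_natCast]; norm_num
  rw [h5, ← div_eq_mul_inv, le_div_iff₀ (by positivity)]
  calc Real.exp (-c * q0 q) * (1 + ‖q‖) ^ 4 ≤ Real.exp (-c * q0 q) * (16 * q0 q ^ 4) := by gcongr
    _ = 16 * (q0 q ^ 4 * Real.exp (-c * q0 q)) := by ring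
    _ ≤ 16 * (C * 1) := by
      have : 0 ≤ C := by positivity
      have h6 : q0 q ^ 4 * Real.exp (-c * q0 q) ≤ C * 1 := h1.trans (by gcongr)
      linarith
    _ = 16 * C := by ring

lemma q0_mul_exp_le {c : ℝ} (hc : 0 < c) (q : Momentum) :
    q0 q * Real.exp (-c * q0 q) ≤ 2 / c * Real.exp (-(c / 2) * q0 q) := by
  have := pow_mul_exp_neg_le 1 hc (q0_pos q).le
  rw [pow_one, pow_one, Nat.factorial_one, Nat.cast_one, one_mul] at this
  exact this

/-- From `1 - e^{-s} ≤ s`; the common lower bound `t` of the exponents preserves the decay. -/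
lemma abs_exp_neg_sub_le {a b t : ℝ} (ha : t ≤ a) (hb : t ≤ b) :
    |Real.exp (-a) - Real.exp (-b)| ≤ Real.exp (-t) * |a - b| := by
  wlog hab : a ≤ b generalizing a b
  · rw [abs_sub_comm, abs_sub_comm a]
    exact this hb ha (le_of_not_ge hab)
  rw [abs_of_nonneg (sub_nonneg.2 (Real.exp_le_exp.2 (by linarith))), abs_sub_comm,
    abs_of_nonneg (sub_nonneg.2 hab)]
  have h1 : Real.exp (-b) = Real.exp (-a) * Real.exp (-(b - a)) := by
    rw [← Real.exp_add]; congr 1; ring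
  have h2 := Real.add_one_le_exp (-(b - a))
  have h3 : Real.exp (-a) ≤ Real.exp (-t) := Real.exp_le_exp.2 (by linarith)
  have h4 := Real.exp_pos (-a)
  calc Real.exp (-a) - Real.exp (-b) = Real.exp (-a) * (1 - Real.exp (-(b - a))) := by
        rw [h1]; ring
    _ ≤ Real.exp (-a) * (b - a) := mul_le_mul_of_nonneg_left (by linarith) h4.le
    _ ≤ Real.exp (-t) * (b - a) := mul_le_mul_of_nonneg_right h3 (by linarith)

lemma maxwellianMass_pos {β : ℝ} (hβ : 0 < β) : 0 < maxwellianMass β := by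
  rw [maxwellianMass, integral_pos_iff_support_of_nonneg (fun _ => (Real.exp_pos _).le)
    (integrable_exp_neg_q0 hβ)]
  have : (Function.support fun q : Momentum => Real.exp (-β * q0 q)) = univ := by
    ext q; simp
  rw [this]
  simp

lemma maxwellianMass_anti {β β' : ℝ} (hβ : 0 < β) (h : β ≤ β') :
    maxwellianMass β' ≤ maxwellianMass β := by
  refine integral_mono (integrable_exp_neg_q0 (hβ.trans_le h)) (integrable_exp_neg_q0 hβ)
    fun q => Real.exp_le_exp.2 ?_
  have := q0_pos q
  nlinarith

/-- Varying `β` costs a factor `q₀`, which is absorbed by halving the decay rate. -/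
lemma exists_maxwellianMass_lipschitz {b : ℝ} (hb : 0 < b) :
    ∃ L, 0 ≤ L ∧ ∀ β β', b ≤ β → b ≤ β' →
      |maxwellianMass β - maxwellianMass β'| ≤ L * |β - β'| := by
  refine ⟨2 / b * maxwellianMass (b / 2), ?_, fun β β' h h' => ?_⟩
  · have := maxwellianMass_pos (half_pos hb)
    positivity
  rw [maxwellianMass, maxwellianMass, ← integral_sub (integrable_exp_neg_q0 (hb.trans_le h))
    (integrable_exp_neg_q0 (hb.trans_le h')), ← Real.norm_eq_abs, maxwellianMass,
    ← integral_const_mul, ← integral_mul_const]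
  refine norm_integral_le_of_norm_le
    (((integrable_exp_neg_q0 (half_pos hb)).const_mul _).mul_const _) (.of_forall fun q => ?_)
  have hq := q0_pos q
  have h1 := abs_exp_neg_sub_le (a := β * q0 q) (b := β' * q0 q) (t := b * q0 q)
    (by gcongr) (by gcongr)
  rw [← sub_mul, abs_mul, abs_of_pos hq] at h1
  rw [Real.norm_eq_abs, neg_mul, neg_mul]
  calc _ ≤ _ := h1
    _ = (q0 q * Real.exp (-b * q0 q)) * |β - β'| := by rw [neg_mul]; ring
    _ ≤ _ := mul_le_mul_of_nonneg_right (q0_mul_exp_le hb q) (abs_nonneg _)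

/-! ### Bounded Lipschitz functions -/

/-- Bounded and Lipschitz on a set. -/
def BddLipOn {X : Type*} [PseudoMetricSpace X] (f : X → ℝ) (s : Set X) : Prop :=
  ∃ C, 0 ≤ C ∧ (∀ x ∈ s, |f x| ≤ C) ∧ ∀ x ∈ s, ∀ y ∈ s, |f x - f y| ≤ C * dist x y

namespace BddLipOn

variable {X : Type*} [PseudoMetricSpace X] {f g : X → ℝ} {s : Set X}

lemma comp (hf : BddLipOn f s) {φ : ℝ → ℝ} {I : Set ℝ} {B L : ℝ} (hL : 0 ≤ L)
    (hI : ∀ x ∈ s, f x ∈ I) (hB : ∀ u ∈ I, |φ u| ≤ B)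
    (hφ : ∀ u ∈ I, ∀ v ∈ I, |φ u - φ v| ≤ L * |u - v|) : BddLipOn (fun x => φ (f x)) s := by
  obtain ⟨C, hC, h1, h2⟩ := hf
  refine ⟨max B (L * C), le_max_of_le_right (by positivity), fun x hx =>
    (hB _ (hI x hx)).trans (le_max_left _ _), fun x hx y hy => ?_⟩
  calc _ ≤ L * |f x - f y| := hφ _ (hI x hx) _ (hI y hy)
    _ ≤ L * (C * dist x y) := by gcongr; exact h2 x hx y hy
    _ = (L * C) * dist x y := by ring
    _ ≤ _ := by gcongr; exact le_max_right _ _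

/-- Boundedness is carried along with the Lipschitz condition because products need it. The class is
thus stable under every operation that builds the Maxwellian's coefficients from the moments. -/
lemma mul (hf : BddLipOn f s) (hg : BddLipOn g s) : BddLipOn (fun x => f x * g x) s := by
  obtain ⟨C, hC, h1, h2⟩ := hf
  obtain ⟨K, hK, k1, k2⟩ := hg
  refine ⟨2 * (C * K), by positivity, fun x hx => ?_, fun x hx y hy => ?_⟩
  · rw [abs_mul]
    have := mul_le_mul (h1 x hx) (k1 x hx) (abs_nonneg _) hC
    have : 0 ≤ C * K := by positivity
    linarith
  · have e : f x * g x - f y * g y = f x * (g x - g y) + (f x - f y) * g y := by ring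
    rw [e]
    refine (abs_add_le _ _).trans ?_
    rw [abs_mul, abs_mul]
    have a1 := mul_le_mul (h1 x hx) (k2 x hx y hy) (abs_nonneg _) hC
    have a2 := mul_le_mul (h2 x hx y hy) (k1 y hy) (abs_nonneg _) (by positivity)
    linarith

lemma sub (hf : BddLipOn f s) (hg : BddLipOn g s) : BddLipOn (fun x => f x - g x) s := by
  obtain ⟨C, hC, h1, h2⟩ := hf
  obtain ⟨K, hK, k1, k2⟩ := hg
  refine ⟨C + K, by positivity, fun x hx => ?_, fun x hx y hy => ?_⟩
  · exact (abs_sub _ _).trans (add_le_add (h1 x hx) (k1 x hx))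
  · have e : f x - g x - (f y - g y) = (f x - f y) - (g x - g y) := by ring
    rw [e, add_mul]
    exact (abs_sub _ _).trans (add_le_add (h2 x hx y hy) (k2 x hx y hy))

lemma add (hf : BddLipOn f s) (hg : BddLipOn g s) : BddLipOn (fun x => f x + g x) s := by
  obtain ⟨C, hC, h1, h2⟩ := hf
  obtain ⟨K, hK, k1, k2⟩ := hg
  refine ⟨C + K, by positivity, fun x hx => ?_, fun x hx y hy => ?_⟩
  · exact (abs_add_le _ _).trans (add_le_add (h1 x hx) (k1 x hx))
  · have e : f x + g x - (f y + g y) = (f x - f y) + (g x - g y) := by ring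
    rw [e, add_mul]
    exact (abs_add_le _ _).trans (add_le_add (h2 x hx y hy) (k2 x hx y hy))

lemma inv (hf : BddLipOn f s) {δ : ℝ} (hδ : 0 < δ) (h : ∀ x ∈ s, δ ≤ f x) :
    BddLipOn (fun x => (f x)⁻¹) s := by
  refine hf.comp (φ := fun u => u⁻¹) (I := Ici δ) (B := δ⁻¹) (L := (δ * δ)⁻¹) (by positivity) h
    ?_ ?_
  · intro u hu
    rw [abs_of_pos (inv_pos.2 (hδ.trans_le hu))]
    exact inv_anti₀ hδ hu
  · intro u hu v hv
    have hu' : 0 < u := hδ.trans_le hu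
    have hv' : 0 < v := hδ.trans_le hv
    rw [inv_sub_inv hu'.ne' hv'.ne', abs_div, abs_of_pos (mul_pos hu' hv'), abs_sub_comm,
      div_eq_inv_mul]
    have : δ * δ ≤ u * v := mul_le_mul hu hv hδ.le hu'.le
    gcongr

lemma sqrt (hf : BddLipOn f s) {δ : ℝ} (hδ : 0 < δ) (h : ∀ x ∈ s, δ ≤ f x) :
    BddLipOn (fun x => √(f x)) s := by
  obtain ⟨C, hC, h1, h2⟩ := hf
  refine comp (φ := fun u => √u) ⟨C, hC, h1, h2⟩ (I := Icc δ C) (B := √C) (L := (√δ)⁻¹)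
    (by positivity) (fun x hx => ⟨h x hx, (le_abs_self _).trans (h1 x hx)⟩) ?_ ?_
  · intro u hu
    rw [abs_of_nonneg (Real.sqrt_nonneg _)]
    exact Real.sqrt_le_sqrt hu.2
  · intro u hu v hv
    have hd := Real.sqrt_pos.2 hδ
    have hu' := Real.sqrt_le_sqrt hu.1
    have hv' := Real.sqrt_nonneg v
    rw [inv_mul_eq_div, le_div_iff₀ hd]
    have e : u - v = (√u - √v) * (√u + √v) := by
      have e1 := Real.sq_sqrt (hδ.le.trans hu.1)
      have e2 := Real.sq_sqrt (hδ.le.trans hv.1)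
      linear_combination -e1 + e2
    rw [e, abs_mul, abs_of_nonneg (a := √u + √v) (by positivity)]
    gcongr
    linarith

end BddLipOn

/-! ### The Maxwellian as a function of the moments -/

/-- The moments `(∫ h, ∫ h q/q₀, ∫ h/q₀)` that determine the local Maxwellian. -/
abbrev MomentSpace : Type := ℝ × (Fin 3 → ℝ) × ℝ

/-- The moments of a distribution. -/
def moments (h : Momentum → ℝ) : MomentSpace :=
  (∫ q, h q, fun i => ∫ q, h q * (q i / q0 q), ∫ q, h q * (1 / q0 q))

/-- Proper density in terms of the moments. -/
def momDensity (m : MomentSpace) : ℝ := √(m.1 ^ 2 - ∑ i, (m.2.1 i) ^ 2)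

/-- `K₁ / K₂` at the equilibrium temperature, in terms of the moments. -/
def momRatio (m : MomentSpace) : ℝ := 1 / momDensity m * m.2.2

/-- Inverse temperature in terms of the moments. -/
def momInvTemp (m : MomentSpace) : ℝ := besselRatioInv (momRatio m)

/-- Velocity in terms of the moments. -/
def momVelocity (m : MomentSpace) : Momentum := (momDensity m)⁻¹ • WithLp.toLp 2 m.2.1

/-- The local Maxwellian in terms of the moments. -/
def gibbs (m : MomentSpace) (q : Momentum) : ℝ :=
  momDensity m / maxwellianMass (momInvTemp m) *
    Real.exp (-momInvTemp m *
      (√(1 + ‖momVelocity m‖ ^ 2) * √(1 + ‖q‖ ^ 2) - inner ℝ (momVelocity m) q))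

lemma ratioMoment_eq (h : Momentum → ℝ) : ratioMoment h = momRatio (moments h) := rfl

/-- Moments with bounded mass, positive `∫ h/q₀`, and temperature ratio at most `c`. -/
def momentSet (a A c : ℝ) : Set MomentSpace :=
  {m | 0 ≤ m.1 ∧ m.1 ≤ A ∧ a ≤ m.2.2 ∧ m.2.2 ≤ c * momDensity m}

lemma continuous_momDensity : Continuous momDensity := by
  unfold momDensity
  fun_prop

/-- The ratio bound is written as `S ≤ c n`, without division, so only non-strict inequalities
between continuous functions occur. Closedness keeps limits of iterates admissible. -/
lemma isClosed_momentSet (a A c : ℝ) : IsClosed (momentSet a A c) := by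
  have := continuous_momDensity
  simp only [momentSet, ofPred_and]
  refine (isClosed_le ?_ ?_).inter ((isClosed_le ?_ ?_).inter
    ((isClosed_le ?_ ?_).inter (isClosed_le ?_ ?_))) <;> fun_prop

section momentSet

variable {a A c : ℝ} {m : MomentSpace}

/-- `a ≤ S ≤ c n ≤ n`: for `a > 0` the density is bounded away from zero without a separate
condition. -/
lemma le_momDensity (hc : c < 1) (hm : m ∈ momentSet a A c) : a ≤ momDensity m := by
  have h := hm.2.2
  have : 0 ≤ momDensity m := Real.sqrt_nonneg _
  nlinarith

/-- The real square root is `0` on negative numbers; since `n > 0`, the radicand is positive and can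
be recovered. -/
lemma momDensity_sq (ha : 0 < a) (hc : c < 1) (hm : m ∈ momentSet a A c) :
    momDensity m ^ 2 = m.1 ^ 2 - ∑ i, (m.2.1 i) ^ 2 := by
  have := Real.sqrt_pos.1 (ha.trans_le (le_momDensity hc hm))
  exact Real.sq_sqrt this.le

lemma momDensity_le (hm : 0 ≤ m.1) : momDensity m ≤ m.1 := by
  apply Real.sqrt_le_iff.2 ⟨hm, ?_⟩
  have : 0 ≤ ∑ i, (m.2.1 i) ^ 2 := Finset.sum_nonneg fun i _ => sq_nonneg _
  linarith

lemma abs_flux_le (ha : 0 < a) (hc : c < 1) (hm : m ∈ momentSet a A c) (i : Fin 3) :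
    |m.2.1 i| ≤ A := by
  have h1 := momDensity_sq ha hc hm
  have h2 : (m.2.1 i) ^ 2 ≤ ∑ i, (m.2.1 i) ^ 2 :=
    Finset.single_le_sum (f := fun i => (m.2.1 i) ^ 2) (fun i _ => sq_nonneg _) (Finset.mem_univ i)
  refine (abs_le_of_sq_le_sq ?_ hm.1).trans hm.2.1
  linarith [sq_nonneg (momDensity m)]

lemma momRatio_mem (ha : 0 < a) (hc : c < 1) (hm : m ∈ momentSet a A c) :
    momRatio m ∈ Icc (a / A) c := by
  have hn := ha.trans_le (le_momDensity hc hm)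
  have hn2 := (momDensity_le hm.1).trans hm.2.1
  obtain ⟨h1, h2, h3, h4⟩ := hm
  rw [momRatio, one_div, inv_mul_eq_div]
  constructor
  · exact div_le_div₀ (ha.le.trans h3) h3 hn hn2
  · rw [div_le_iff₀ hn]; exact h4

/-- Here `|F|² = ρ² - n² ≤ (ρ - n²/(2ρ))²`, so `F · q ≤ |F| |q| ≤ (ρ - n²/(2ρ)) q₀`. This coercivity
makes the decay of the Maxwellian uniform in the velocity. -/
lemma energy_lower_bound (ha : 0 < a) (hc : c < 1) (hm : m ∈ momentSet a A c) (q : Momentum) :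
    momDensity m ^ 2 / (2 * m.1) * q0 q ≤ m.1 * q0 q - ∑ i, m.2.1 i * q i := by
  have hn := ha.trans_le (le_momDensity hc hm)
  have hsq := momDensity_sq ha hc hm
  have hle := momDensity_le hm.1
  have hρ : 0 < m.1 := hn.trans_le hle
  have hq := q0_pos q
  set n := momDensity m
  have hcs := Finset.sum_mul_sq_le_sq_mul_sq Finset.univ (fun i => m.2.1 i) (fun i => q i)
  have hnq : ∑ i, (q i) ^ 2 = ‖q‖ ^ 2 := by
    rw [EuclideanSpace.real_norm_sq_eq]
  have hqn : ‖q‖ ^ 2 ≤ q0 q ^ 2 := by rw [q0_sq]; linarith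
  have h1 : n ^ 2 / (2 * m.1) ≤ m.1 := by
    rw [div_le_iff₀ (by positivity)]
    nlinarith
  have h2 : m.1 ^ 2 - n ^ 2 ≤ (m.1 - n ^ 2 / (2 * m.1)) ^ 2 := by
    have e : (m.1 - n ^ 2 / (2 * m.1)) ^ 2 = m.1 ^ 2 - n ^ 2 + (n ^ 2 / (2 * m.1)) ^ 2 := by
      field_simp
      ring
    rw [e]
    linarith [sq_nonneg (n ^ 2 / (2 * m.1))]
  have h3 : (∑ i, m.2.1 i * q i) ^ 2 ≤ ((m.1 - n ^ 2 / (2 * m.1)) * q0 q) ^ 2 := by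
    rw [mul_pow]
    refine hcs.trans ?_
    rw [hnq]
    refine mul_le_mul ?_ hqn (sq_nonneg _) (sq_nonneg _)
    linarith
  have h4 := abs_le_of_sq_le_sq h3 (mul_nonneg (by linarith) hq.le)
  have h5 := le_abs_self (∑ i, m.2.1 i * q i)
  linarith

/-- Since `u = F/n` and `n² = ρ² - |F|²`, one has `√(1+|u|²) = ρ/n`. Up to the factor `β/n`, the
exponent is then linear in `(ρ, F)`. -/
lemma gibbs_eq (ha : 0 < a) (hc : c < 1) (hm : m ∈ momentSet a A c) (q : Momentum) :
    gibbs m q = momDensity m * (maxwellianMass (momInvTemp m))⁻¹ *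
      Real.exp (-(momInvTemp m * (momDensity m)⁻¹ * (m.1 * q0 q - ∑ i, m.2.1 i * q i))) := by
  have hn := ha.trans_le (le_momDensity hc hm)
  have hsq := momDensity_sq ha hc hm
  have hle := momDensity_le hm.1
  have hρ : 0 < m.1 := hn.trans_le hle
  have h1 : √(1 + ‖momVelocity m‖ ^ 2) = (momDensity m)⁻¹ * m.1 := by
    rw [momVelocity, norm_smul, mul_pow, EuclideanSpace.real_norm_sq_eq, Real.norm_of_nonneg
      (by positivity)]
    have : 1 + (momDensity m)⁻¹ ^ 2 * ∑ i, (m.2.1 i) ^ 2 = ((momDensity m)⁻¹ * m.1) ^ 2 := by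
      have h2 : ∑ i, (m.2.1 i) ^ 2 = m.1 ^ 2 - momDensity m ^ 2 := by linarith
      rw [h2]
      field_simp
      ring
    rw [this]
    exact Real.sqrt_sq (by positivity)
  have h2 : inner ℝ (momVelocity m) q = (momDensity m)⁻¹ * ∑ i, m.2.1 i * q i := by
    rw [momVelocity, real_inner_smul_left, PiLp.inner_apply]
    congr 1
    refine Finset.sum_congr rfl fun i _ => ?_
    simp [mul_comm]
  rw [gibbs, h1, h2, div_eq_mul_inv, ← q0]
  congr 2
  ring

end momentSet

/-- On `momentSet` the local Maxwellian is bounded by, and Lipschitz in the moments with constant,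
a multiple of a fixed Gibbs factor. -/
lemma exists_gibbs_bounds {a A c : ℝ} (ha : 0 < a) (hA : 0 < A) (hc : c < 1) :
    ∃ C b : ℝ, 0 < C ∧ 0 < b ∧
      (∀ m ∈ momentSet a A c, ∀ q, 0 ≤ gibbs m q ∧ gibbs m q ≤ C * Real.exp (-b * q0 q)) ∧
      ∀ m ∈ momentSet a A c, ∀ m' ∈ momentSet a A c, ∀ q,
        |gibbs m q - gibbs m' q| ≤ C * dist m m' * Real.exp (-b * q0 q) := by
  set s := momentSet a A c with hs
  obtain ⟨b₁, b₂, L, hb₁, hL, hmem, hlip⟩ := exists_besselRatioInv_bounds (r₁ := a / A) (r₂ := c)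
    (by positivity) hc
  have hdist1 : ∀ x y : MomentSpace, |x.1 - y.1| ≤ 1 * dist x y := fun x y => by
    rw [one_mul, ← Real.dist_eq, Prod.dist_eq]; exact le_max_left _ _
  have hdist2 : ∀ x y : MomentSpace, ∀ i, |x.2.1 i - y.2.1 i| ≤ 1 * dist x y := fun x y i => by
    rw [one_mul, ← Real.dist_eq, Prod.dist_eq, Prod.dist_eq]
    exact (dist_le_pi_dist _ _ i).trans ((le_max_left _ _).trans (le_max_right _ _))
  have hdist3 : ∀ x y : MomentSpace, |x.2.2 - y.2.2| ≤ 1 * dist x y := fun x y => by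
    rw [one_mul, ← Real.dist_eq, Prod.dist_eq, Prod.dist_eq]
    exact (le_max_right _ _).trans (le_max_right _ _)
  have hAA : A ≤ max A 1 := le_max_left _ _
  have hA1 : (1 : ℝ) ≤ max A 1 := le_max_right _ _
  have hρ : BddLipOn (fun m : MomentSpace => m.1) s := by
    refine ⟨max A 1, by positivity, fun x hx => ?_, fun x hx y hy => (hdist1 x y).trans
      (by gcongr)⟩
    rw [abs_of_nonneg hx.1]
    exact hx.2.1.trans hAA
  have hF : ∀ i, BddLipOn (fun m : MomentSpace => m.2.1 i) s := fun i =>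
    ⟨max A 1, by positivity, fun x hx => (abs_flux_le ha hc hx i).trans hAA,
      fun x hx y hy => (hdist2 x y i).trans (by gcongr)⟩
  have hS : BddLipOn (fun m : MomentSpace => m.2.2) s := by
    refine ⟨max A 1, by positivity, fun x hx => ?_, fun x hx y hy => (hdist3 x y).trans
      (by gcongr)⟩
    rw [abs_of_nonneg (ha.le.trans hx.2.2.1)]
    have h0 := ha.trans_le (le_momDensity hc hx)
    have h1 := (momDensity_le hx.1).trans hx.2.1
    have h2 := hx.2.2.2
    nlinarith
  have hn : BddLipOn momDensity s := by
    have h : BddLipOn (fun m : MomentSpace => m.1 ^ 2 - ∑ i, (m.2.1 i) ^ 2) s := by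
      simp only [Fin.sum_univ_three, sq]
      exact (hρ.mul hρ).sub ((((hF 0).mul (hF 0)).add ((hF 1).mul (hF 1))).add
        ((hF 2).mul (hF 2)))
    refine h.sqrt (δ := a ^ 2) (by positivity) fun x hx => ?_
    rw [← momDensity_sq ha hc hx]
    have := le_momDensity hc hx
    gcongr
  have hninv := hn.inv ha fun x hx => le_momDensity hc hx
  have hr : BddLipOn momRatio s := by
    have h := hninv.mul hS
    simp only [← one_div] at h
    exact h
  have hβ : BddLipOn momInvTemp s :=
    hr.comp (B := b₂) (I := Icc (a / A) c) hL (fun x hx => momRatio_mem ha hc hx)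
      (fun u hu => by
        rw [abs_of_pos (hb₁.trans_le (hmem u hu).1)]; exact (hmem u hu).2) hlip
  have hβmem : ∀ m ∈ s, momInvTemp m ∈ Icc b₁ b₂ := fun m hm => hmem _ (momRatio_mem ha hc hm)
  obtain ⟨LM, hLM, hlipM⟩ := exists_maxwellianMass_lipschitz hb₁
  have hM : BddLipOn (fun m => maxwellianMass (momInvTemp m)) s :=
    hβ.comp (I := Icc b₁ b₂) (B := maxwellianMass b₁) hLM hβmem
      (fun u hu => by
        rw [abs_of_pos (maxwellianMass_pos (hb₁.trans_le hu.1))]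
        exact maxwellianMass_anti hb₁ hu.1)
      (fun u hu v hv => hlipM u v hu.1 hv.1)
  have hpre : BddLipOn (fun m => momDensity m * (maxwellianMass (momInvTemp m))⁻¹) s := by
    -- A point of `s` is used to see that `b₂ > 0`; on the empty set there is nothing to prove.
    by_cases hne : s.Nonempty
    · obtain ⟨m₀, hm₀⟩ := hne
      have hb₂ : 0 < b₂ := hb₁.trans_le ((hβmem m₀ hm₀).1.trans (hβmem m₀ hm₀).2)
      exact hn.mul (hM.inv (maxwellianMass_pos hb₂) fun x hx =>
        maxwellianMass_anti (hb₁.trans_le (hβmem x hx).1) (hβmem x hx).2)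
    · rw [not_nonempty_iff_eq_empty] at hne
      rw [hne]
      exact ⟨0, le_rfl, by simp, by simp⟩
  have hb := hβ.mul hninv
  obtain ⟨C₁, hC₁, p1, p2⟩ := hpre
  obtain ⟨C₂, hC₂, -, e0⟩ := hb.mul hρ
  have hbF := fun i => hb.mul (hF i)
  choose C₃ hC₃ _ e3 using hbF
  -- The energy bound times `β/n` gives the rate `β n / (2ρ)`, which is at least `b₁ a / (2A)`.
  -- Below, `K` is the Lipschitz constant of the exponent per unit of `q₀`.
  set d := b₁ * a / (2 * A) with hd
  have hd0 : 0 < d := by positivity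
  set K := C₂ + ∑ i, C₃ i with hK
  have hK0 : 0 ≤ K := add_nonneg hC₂ (Finset.sum_nonneg fun i _ => hC₃ i)
  have hexp : ∀ m ∈ s, ∀ q, d * q0 q ≤
      momInvTemp m * (momDensity m)⁻¹ * (m.1 * q0 q - ∑ i, m.2.1 i * q i) := by
    intro m hm q
    have h1 := energy_lower_bound ha hc hm q
    have hn0 := ha.trans_le (le_momDensity hc hm)
    have hρ0 := hn0.trans_le (momDensity_le hm.1)
    have hβ0 := hb₁.trans_le (hβmem m hm).1
    have hq := q0_pos q
    calc d * q0 q ≤ (momInvTemp m * momDensity m / (2 * m.1)) * q0 q := by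
          have := (hβmem m hm).1
          have := le_momDensity hc hm
          have := hm.2.1
          rw [hd]
          gcongr
      _ = momInvTemp m * (momDensity m)⁻¹ * (momDensity m ^ 2 / (2 * m.1) * q0 q) := by
          field_simp
      _ ≤ _ := by gcongr
  have hmono : ∀ q, Real.exp (-(d * q0 q)) ≤ Real.exp (-(d / 2) * q0 q) := fun q =>
    Real.exp_le_exp.2 (by nlinarith [q0_pos q])
  -- `C₁` controls the prefactor and its variation; `C₁ K (2/d)` controls the variation of the
  -- exponent, whose factor `q₀` lowers the rate to `d/2`. The `+ 1` only ensures positivity.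
  refine ⟨C₁ + C₁ * K * (2 / d) + 1, d / 2, by positivity, by positivity, fun m hm q => ?_,
    fun m hm m' hm' q => ?_⟩
  · rw [gibbs_eq ha hc hm]
    have hn0 := ha.trans_le (le_momDensity hc hm)
    have hM0 := maxwellianMass_pos (hb₁.trans_le (hβmem m hm).1)
    refine ⟨by positivity, ?_⟩
    have h1 : Real.exp (-(momInvTemp m * (momDensity m)⁻¹ *
        (m.1 * q0 q - ∑ i, m.2.1 i * q i))) ≤ Real.exp (-(d / 2) * q0 q) :=
      (Real.exp_le_exp.2 (neg_le_neg (hexp m hm q))).trans (hmono q)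
    have h2 := (le_abs_self _).trans (p1 m hm)
    have h3 : C₁ ≤ C₁ + C₁ * K * (2 / d) + 1 := by
      have : 0 ≤ C₁ * K * (2 / d) := by positivity
      linarith
    exact mul_le_mul (h2.trans h3) h1 (Real.exp_pos _).le (by positivity)
  · rw [gibbs_eq ha hc hm, gibbs_eq ha hc hm']
    set P := momDensity m * (maxwellianMass (momInvTemp m))⁻¹
    set P' := momDensity m' * (maxwellianMass (momInvTemp m'))⁻¹
    set x := momInvTemp m * (momDensity m)⁻¹ * (m.1 * q0 q - ∑ i, m.2.1 i * q i) with hx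
    set x' := momInvTemp m' * (momDensity m')⁻¹ * (m'.1 * q0 q - ∑ i, m'.2.1 i * q i) with hx'
    have hq := q0_pos q
    have hxx : |x - x'| ≤ K * dist m m' * q0 q := by
      have e : x - x' = (momInvTemp m * (momDensity m)⁻¹ * m.1 -
          momInvTemp m' * (momDensity m')⁻¹ * m'.1) * q0 q -
          ∑ i, (momInvTemp m * (momDensity m)⁻¹ * m.2.1 i -
          momInvTemp m' * (momDensity m')⁻¹ * m'.2.1 i) * q i := by
        rw [hx, hx']
        simp only [Fin.sum_univ_three]
        ring
      rw [e]
      refine (abs_sub _ _).trans ?_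
      have t1 : |(momInvTemp m * (momDensity m)⁻¹ * m.1 -
          momInvTemp m' * (momDensity m')⁻¹ * m'.1) * q0 q| ≤ C₂ * dist m m' * q0 q := by
        rw [abs_mul, abs_of_pos hq]
        gcongr
        exact e0 m hm m' hm'
      have t2 : |∑ i, (momInvTemp m * (momDensity m)⁻¹ * m.2.1 i -
          momInvTemp m' * (momDensity m')⁻¹ * m'.2.1 i) * q i| ≤
          ∑ i, C₃ i * dist m m' * q0 q := by
        refine (Finset.abs_sum_le_sum_abs _ _).trans (Finset.sum_le_sum fun i _ => ?_)
        rw [abs_mul]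
        have := e3 i m hm m' hm'
        have := hC₃ i
        gcongr
        exact abs_apply_le_q0 q i
      rw [← Finset.sum_mul, ← Finset.sum_mul] at t2
      rw [hK]
      linarith
    have h1 := abs_exp_neg_sub_le (hexp m hm q) (hexp m' hm' q)
    have h2 : Real.exp (-x') ≤ Real.exp (-(d * q0 q)) :=
      Real.exp_le_exp.2 (neg_le_neg (hexp m' hm' q))
    have e : P * Real.exp (-x) - P' * Real.exp (-x') =
      P * (Real.exp (-x) - Real.exp (-x')) + (P - P') * Real.exp (-x') := by ring
    rw [e]
    refine (abs_add_le _ _).trans ?_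
    rw [abs_mul P, abs_mul (P - P'), abs_of_pos (Real.exp_pos (-x'))]
    have hqe := q0_mul_exp_le hd0 q
    have t1 : |P| * |Real.exp (-x) - Real.exp (-x')| ≤
        C₁ * (K * dist m m' * (2 / d * Real.exp (-(d / 2) * q0 q))) := by
      refine mul_le_mul (p1 m hm) (h1.trans ?_) (abs_nonneg _) hC₁
      calc Real.exp (-(d * q0 q)) * |x - x'|
          ≤ Real.exp (-(d * q0 q)) * (K * dist m m' * q0 q) := by gcongr
        _ = K * dist m m' * (q0 q * Real.exp (-d * q0 q)) := by rw [neg_mul]; ring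
        _ ≤ _ := by gcongr
    have t2 : |P - P'| * Real.exp (-x') ≤ C₁ * dist m m' * Real.exp (-(d / 2) * q0 q) :=
      mul_le_mul (p2 m hm m' hm') (h2.trans (hmono q)) (Real.exp_pos _).le (by positivity)
    have t3 : 0 ≤ dist m m' * Real.exp (-(d / 2) * q0 q) := by positivity
    linarith

/-! ### Inequalities between moments -/

lemma abs_apply_div_q0_le (i : Fin 3) (q : Momentum) : |q i / q0 q| ≤ 1 := by
  rw [abs_div, abs_of_pos (q0_pos q), div_le_one (q0_pos q)]
  exact abs_apply_le_q0 q i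

lemma one_div_q0_le (q : Momentum) : 1 / q0 q ≤ 1 := by
  rw [div_le_one (q0_pos q)]; exact one_le_q0 q

lemma one_div_q0_sq_le (q : Momentum) : 1 / q0 q ^ 2 ≤ 1 / q0 q := by
  apply one_div_le_one_div_of_le (q0_pos q)
  nlinarith [one_le_q0 q]

lemma continuous_apply_div_q0 (i : Fin 3) : Continuous fun q : Momentum => q i / q0 q :=
  Continuous.div (by fun_prop) continuous_q0 fun q => (q0_pos q).ne'

lemma continuous_one_div_q0 : Continuous fun q : Momentum => 1 / q0 q :=
  continuous_const.div continuous_q0 fun q => (q0_pos q).ne'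

lemma continuous_one_div_q0_sq : Continuous fun q : Momentum => 1 / q0 q ^ 2 :=
  continuous_const.div (continuous_q0.pow 2) fun q => pow_ne_zero _ (q0_pos q).ne'

lemma integrable_mul_of_abs_le_one {h φ : Momentum → ℝ} (hh : Integrable h) (hφ : Continuous φ)
    (hb : ∀ q, |φ q| ≤ 1) : Integrable fun q => h q * φ q := by
  refine hh.mono (hh.1.mul hφ.aestronglyMeasurable) (.of_forall fun q => ?_)
  rw [norm_mul, Real.norm_eq_abs (φ q)]
  exact mul_le_of_le_one_right (norm_nonneg _) (hb q)

lemma integrable_mul_one_div_q0 {h : Momentum → ℝ} (hh : Integrable h) :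
    Integrable fun q => h q * (1 / q0 q) :=
  integrable_mul_of_abs_le_one hh continuous_one_div_q0 fun q => by
    rw [abs_of_pos (by have := q0_pos q; positivity)]
    exact one_div_q0_le q

lemma integrable_mul_one_div_q0_sq {h : Momentum → ℝ} (hh : Integrable h) :
    Integrable fun q => h q * (1 / q0 q ^ 2) :=
  integrable_mul_of_abs_le_one hh continuous_one_div_q0_sq fun q => by
    rw [abs_of_pos (by have := q0_pos q; positivity)]
    exact (one_div_q0_sq_le q).trans (one_div_q0_le q)

lemma integrable_mul_apply_div_q0 {h : Momentum → ℝ} (hh : Integrable h) (i : Fin 3) :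
    Integrable fun q : Momentum => h q * (q i / q0 q) :=
  integrable_mul_of_abs_le_one hh (continuous_apply_div_q0 i) (abs_apply_div_q0_le i)

lemma integrable_mul_apply_div_q0_sq {h : Momentum → ℝ} (hh : Integrable h) (i : Fin 3) :
    Integrable fun q : Momentum => h q * (q i / q0 q) ^ 2 :=
  integrable_mul_of_abs_le_one hh ((continuous_apply_div_q0 i).pow 2) fun q => by
    rw [abs_pow]
    exact pow_le_one₀ (abs_nonneg _) (abs_apply_div_q0_le i q)

lemma sum_apply_div_q0_sq (q : Momentum) : ∑ i, (q i / q0 q) ^ 2 = 1 - 1 / q0 q ^ 2 := by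
  have h1 := q0_sq q
  have h2 := q0_pos q
  simp only [div_pow]
  rw [← Finset.sum_div, ← EuclideanSpace.real_norm_sq_eq]
  field_simp
  linarith

/-- The proper density dominates the geometric mean of `∫ h` and `∫ h / q₀²`. -/
lemma sqrt_le_momDensity {h : Momentum → ℝ} (hh : Integrable h) (hn : 0 ≤ᵐ[volume] h) :
    √((∫ q, h q) * ∫ q, h q * (1 / q0 q ^ 2)) ≤ momDensity (moments h) := by
  apply Real.sqrt_le_sqrt
  have h1 : ∀ i : Fin 3, (∫ q, h q * (q i / q0 q)) ^ 2 ≤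
      (∫ q, h q) * ∫ q, h q * (q i / q0 q) ^ 2 := fun i =>
    sq_integral_mul_le hn hh (integrable_mul_apply_div_q0 hh i) (integrable_mul_apply_div_q0_sq hh i)
  -- Because `|q|²/q₀² = 1 - 1/q₀²`, summing the componentwise Cauchy–Schwarz inequalities gives
  -- `|F|² ≤ ρ (ρ - ∫ h/q₀²)`.
  have h2 : ∑ i : Fin 3, ∫ q, h q * (q i / q0 q) ^ 2 =
      (∫ q, h q) - ∫ q, h q * (1 / q0 q ^ 2) := by
    rw [← integral_finsetSum _ fun i _ => integrable_mul_apply_div_q0_sq hh i,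
      ← integral_sub hh (integrable_mul_one_div_q0_sq hh)]
    congr 1
    ext q
    rw [← Finset.mul_sum, sum_apply_div_q0_sq]
    ring
  have h3 : ∑ i : Fin 3, (∫ q, h q * (q i / q0 q)) ^ 2 ≤
      ∑ i : Fin 3, (∫ q, h q) * ∫ q, h q * (q i / q0 q) ^ 2 :=
    Finset.sum_le_sum fun i _ => h1 i
  rw [← Finset.mul_sum, h2] at h3
  simp only [moments]
  linarith

lemma integral_one_div_q0_sq_le {h : Momentum → ℝ} (hh : Integrable h) (hn : 0 ≤ᵐ[volume] h) :
    ∫ q, h q * (1 / q0 q ^ 2) ≤ ∫ q, h q * (1 / q0 q) := by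
  refine integral_mono_ae (integrable_mul_one_div_q0_sq hh) (integrable_mul_one_div_q0 hh) ?_
  filter_upwards [hn] with q hq
  exact mul_le_mul_of_nonneg_left (one_div_q0_sq_le q) hq

lemma integral_one_div_q0_le {h : Momentum → ℝ} (hh : Integrable h) (hn : 0 ≤ᵐ[volume] h) :
    ∫ q, h q * (1 / q0 q) ≤ ∫ q, h q := by
  refine integral_mono_ae (integrable_mul_one_div_q0 hh) hh ?_
  filter_upwards [hn] with q hq
  exact mul_le_of_le_one_right hq (one_div_q0_le q)

/-- Equality in the Cauchy–Schwarz inequality is impossible, because `q₀` is not constant on a set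
of positive measure. -/
lemma sq_integral_one_div_q0_lt {h : Momentum → ℝ} (hh : Integrable h) (hn : 0 ≤ᵐ[volume] h)
    (hpos : 0 < ∫ q, h q) :
    (∫ q, h q * (1 / q0 q)) ^ 2 < (∫ q, h q) * ∫ q, h q * (1 / q0 q ^ 2) := by
  have e : (fun q => h q * (1 / q0 q ^ 2)) = fun q => h q * (1 / q0 q) ^ 2 := by
    ext q; rw [div_pow, one_pow]
  have hi := integrable_mul_one_div_q0_sq hh
  rw [e] at hi ⊢
  refine sq_integral_mul_lt hn hh (integrable_mul_one_div_q0 hh) hi hpos fun t ht => ?_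
  -- Equality would force `1/q₀ = t` wherever `h ≠ 0`, that is, `h` would live on a sphere, which is
  -- a null set.
  have hs : volume (Metric.sphere (0 : Momentum) (√((1 / t) ^ 2 - 1))) = 0 :=
    Measure.addHaar_sphere _ _ _
  have h0 : h =ᵐ[volume] 0 := by
    filter_upwards [ht, compl_mem_ae_iff.2 hs] with q hq hqs
    by_contra hne
    rcases mul_eq_zero.1 hq with h1 | h1
    · exact hne h1
    · apply hqs
      have h2 : 1 / q0 q = t := by
        have := pow_eq_zero_iff (two_ne_zero) |>.1 h1
        linarith
      rw [mem_sphere_zero_iff_norm, ← h2, one_div_one_div, q0_sq, add_sub_cancel_left]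
      exact (Real.sqrt_sq (norm_nonneg q)).symm
  rw [integral_congr_ae h0] at hpos
  simp at hpos

/-- Every moment is an integral against a function bounded by `1`, and the product metric is a
maximum, so the constant is `1`. -/
lemma dist_moments_le {h h' : Momentum → ℝ} (hh : Integrable h) (hh' : Integrable h') :
    dist (moments h) (moments h') ≤ ∫ q, |h q - h' q| := by
  have key : ∀ φ : Momentum → ℝ, Continuous φ → (∀ q, |φ q| ≤ 1) →
      dist (∫ q, h q * φ q) (∫ q, h' q * φ q) ≤ ∫ q, |h q - h' q| := by
    intro φ hφ hb
    rw [Real.dist_eq, ← integral_sub (integrable_mul_of_abs_le_one hh hφ hb)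
      (integrable_mul_of_abs_le_one hh' hφ hb), ← Real.norm_eq_abs]
    refine norm_integral_le_of_norm_le (hh.sub hh').abs (.of_forall fun q => ?_)
    rw [← sub_mul, norm_mul]
    exact mul_le_of_le_one_right (norm_nonneg _) (hb q)
  have hk := key (fun _ => 1) continuous_const (by simp)
  simp only [mul_one] at hk
  rw [moments, moments, Prod.dist_eq, Prod.dist_eq]
  refine max_le hk (max_le ?_ ?_)
  · rw [dist_pi_le_iff (integral_nonneg fun q => abs_nonneg _)]
    exact fun i => key _ (continuous_apply_div_q0 i) (abs_apply_div_q0_le i)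
  · refine key _ continuous_one_div_q0 fun q => ?_
    rw [abs_of_pos (by have := q0_pos q; positivity)]
    exact one_div_q0_le q

lemma moments_congr {h h' : Momentum → ℝ} (hh : h =ᵐ[volume] h') : moments h = moments h' := by
  have key : ∀ φ : Momentum → ℝ, ∫ q, h q * φ q = ∫ q, h' q * φ q := fun φ =>
    integral_congr_ae (by filter_upwards [hh] with q hq; rw [hq])
  simp only [moments, key, integral_congr_ae hh]

lemma measurable_moments {X : Type*} [MeasurableSpace X] {f : X → Momentum → ℝ}
    (hf : Measurable (Function.uncurry f)) : Measurable fun x => moments (f x) := by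
  have key : ∀ φ : Momentum → ℝ, Continuous φ → Measurable fun x => ∫ q, f x q * φ q :=
    fun φ hφ => (StronglyMeasurable.integral_prod_right
      (f := fun x q => f x q * φ q)
      (hf.mul (hφ.measurable.comp measurable_snd)).stronglyMeasurable).measurable
  have h1 := key (fun _ => 1) continuous_const
  simp only [mul_one] at h1
  exact h1.prodMk ((measurable_pi_lambda _ fun i => key _ (continuous_apply_div_q0 i)).prodMk
    (key _ continuous_one_div_q0))

/-- For the uniqueness part, where a competitor is only an `L¹` function on the slab; the
fixed-point iteration uses the everywhere measurable version. -/
lemma aemeasurable_moments {X : Type*} [MeasurableSpace X] {μ : Measure X} [SFinite μ]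
    {f : X → Momentum → ℝ} (hf : AEStronglyMeasurable (Function.uncurry f) (μ.prod volume)) :
    AEMeasurable (fun x => moments (f x)) μ := by
  have key : ∀ φ : Momentum → ℝ, Continuous φ → AEMeasurable (fun x => ∫ q, f x q * φ q) μ :=
    fun φ hφ => (AEStronglyMeasurable.integral_prod_right'
      (f := fun z : X × Momentum => f z.1 z.2 * φ z.2)
      (hf.mul (hφ.comp_stronglyMeasurable
        measurable_snd.stronglyMeasurable).aestronglyMeasurable)).aemeasurable
  have h1 := key (fun _ => 1) continuous_const
  simp only [mul_one] at h1
  exact h1.prodMk ((aemeasurable_pi_lambda _ fun i => key _ (continuous_apply_div_q0 i)).prodMk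
    (key _ continuous_one_div_q0))

/-! ### The transport kernel -/

/-- The kernel `(w/|q₁|) e^{-(w/|q₁|)|x-y|}`, restricted to `y ≤ x` for `q₁ > 0` and to `x ≤ y` for
`q₁ < 0`. -/
def transportKernel (w x : ℝ) (q : Momentum) (y : ℝ) : ℝ :=
  if 0 < q 0 then if y ≤ x then w / |q 0| * Real.exp (-(w / |q 0|) * (x - y)) else 0
  else if q 0 < 0 then if x ≤ y then w / |q 0| * Real.exp (-(w / |q 0|) * (y - x)) else 0
  else 0

lemma transportKernel_nonneg {w : ℝ} (hw : 0 < w) (x : ℝ) (q : Momentum) (y : ℝ) :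
    0 ≤ transportKernel w x q y := by
  unfold transportKernel
  split_ifs <;> positivity

lemma transportKernel_le {w : ℝ} (hw : 0 < w) (x : ℝ) (q : Momentum) (y : ℝ) :
    transportKernel w x q y ≤ w / |q 0| := by
  have h0 : 0 ≤ w / |q 0| := by positivity
  have h1 : ∀ t, 0 ≤ t → w / |q 0| * Real.exp (-(w / |q 0|) * t) ≤ w / |q 0| := fun t ht =>
    mul_le_of_le_one_right h0 (Real.exp_le_one_iff.2 (by nlinarith))
  unfold transportKernel
  split_ifs
  · exact h1 _ (by linarith)
  · exact h0
  · exact h1 _ (by linarith)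
  · exact h0
  · exact h0

lemma measurable_apply_zero : Measurable fun q : Momentum => q 0 :=
  (by fun_prop : Continuous fun q : Momentum => q 0).measurable

lemma measurable_transportKernel (w : ℝ) :
    Measurable fun p : (ℝ × Momentum) × ℝ => transportKernel w p.1.1 p.1.2 p.2 := by
  have hq : Measurable fun p : (ℝ × Momentum) × ℝ => p.1.2 0 :=
    measurable_apply_zero.comp (measurable_snd.comp measurable_fst)
  have hx : Measurable fun p : (ℝ × Momentum) × ℝ => p.1.1 := measurable_fst.comp measurable_fst
  have hy : Measurable fun p : (ℝ × Momentum) × ℝ => p.2 := measurable_snd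
  unfold transportKernel
  refine Measurable.ite (measurableSet_lt measurable_const hq)
    (Measurable.ite (measurableSet_le hy hx) (by fun_prop) measurable_const)
    (Measurable.ite (measurableSet_lt hq measurable_const)
    (Measurable.ite (measurableSet_le hx hy) (by fun_prop) measurable_const) measurable_const)

/-- Both one-sided integrals become integrals over the fixed interval `[0,1]`, so that joint
measurability and domination can be treated at once. -/
lemma integral_transportKernel_mul {w x : ℝ} (hx : x ∈ Icc (0 : ℝ) 1) (q : Momentum)
    (g : ℝ → ℝ) :
    ∫ y in Icc (0 : ℝ) 1, transportKernel w x q y * g y =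
      if 0 < q 0 then
        w / |q 0| * ∫ y in (0 : ℝ)..x, Real.exp (-(w / |q 0|) * (x - y)) * g y
      else if q 0 < 0 then
        w / |q 0| * ∫ y in x..(1 : ℝ), Real.exp (-(w / |q 0|) * (y - x)) * g y
      else 0 := by
  unfold transportKernel
  split_ifs with h1 h2
  · have e : (fun y => (if y ≤ x then w / |q 0| * Real.exp (-(w / |q 0|) * (x - y)) else 0) * g y) =
        (Iic x).indicator fun y => w / |q 0| * (Real.exp (-(w / |q 0|) * (x - y)) * g y) := by
      ext y
      by_cases hy : y ≤ x <;> simp [hy, mul_assoc]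
    have hs : Icc (0 : ℝ) 1 ∩ Iic x = Icc 0 x := by
      ext y
      simp only [mem_inter_iff, mem_Icc, mem_Iic]
      exact ⟨fun h => ⟨h.1.1, h.2⟩, fun h => ⟨⟨h.1, h.2.trans hx.2⟩, h.2⟩⟩
    rw [e, setIntegral_indicator measurableSet_Iic, hs, integral_const_mul,
      intervalIntegral.integral_of_le hx.1, integral_Icc_eq_integral_Ioc]
  · have e : (fun y => (if x ≤ y then w / |q 0| * Real.exp (-(w / |q 0|) * (y - x)) else 0) * g y) =
        (Ici x).indicator fun y => w / |q 0| * (Real.exp (-(w / |q 0|) * (y - x)) * g y) := by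
      ext y
      by_cases hy : x ≤ y <;> simp [hy, mul_assoc]
    have hs : Icc (0 : ℝ) 1 ∩ Ici x = Icc x 1 := by
      ext y
      simp only [mem_inter_iff, mem_Icc, mem_Ici]
      exact ⟨fun h => ⟨h.2, h.1.2⟩, fun h => ⟨⟨hx.1.trans h.1, h.2⟩, h.1⟩⟩
    rw [e, setIntegral_indicator measurableSet_Ici, hs, integral_const_mul,
      intervalIntegral.integral_of_le hx.2, integral_Icc_eq_integral_Ioc]
  · simp

lemma integrable_transportKernel {w : ℝ} (hw : 0 < w) (x : ℝ) (q : Momentum) :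
    Integrable (transportKernel w x q) (volume.restrict (Icc 0 1)) := by
  refine Integrable.mono' (integrable_const (w / |q 0|))
    ((measurable_transportKernel w).comp (measurable_const (a := (x, q)) |>.prodMk
      measurable_id)).aestronglyMeasurable (.of_forall fun y => ?_)
  rw [Real.norm_of_nonneg (transportKernel_nonneg hw x q y)]
  exact transportKernel_le hw x q y

/-- With `α = w/|q₁|` the mass is `1 - e^{-αx}` or `1 - e^{-α(1-x)}`. When `q₁ = 0` both sides are
`0`, division by zero giving `α = 0`. -/
lemma integral_transportKernel_le {w x : ℝ} (hw : 0 < w) (hx : x ∈ Icc (0 : ℝ) 1) (q : Momentum) :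
    ∫ y in Icc (0 : ℝ) 1, transportKernel w x q y ≤ 1 - Real.exp (-(w / |q 0|)) := by
  have h := integral_transportKernel_mul (w := w) hx q fun _ => 1
  simp only [mul_one] at h
  rw [h]
  have hα : 0 ≤ w / |q 0| := by positivity
  set α := w / |q 0|
  have hexp : ∀ t ≤ (1 : ℝ), Real.exp (-α) ≤ Real.exp (-α * t) := fun t ht =>
    Real.exp_le_exp.2 (by nlinarith)
  split_ifs with h1 h2
  · rw [← intervalIntegral.integral_const_mul,
      intervalIntegral.integral_eq_sub_of_hasDerivAt (f := fun y => Real.exp (-α * (x - y)))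
        (fun y _ => ?_) (Continuous.intervalIntegrable (by fun_prop) _ _)]
    · simp only [sub_self, mul_zero, Real.exp_zero, sub_zero]
      linarith [hexp x hx.2]
    · have := ((hasDerivAt_id y).const_sub x).const_mul (-α)
      exact this.exp.congr_deriv (by simp [mul_comm])
  · rw [← intervalIntegral.integral_const_mul,
      intervalIntegral.integral_eq_sub_of_hasDerivAt (f := fun y => -Real.exp (-α * (y - x)))
        (fun y _ => ?_) (Continuous.intervalIntegrable (by fun_prop) _ _)]
    · simp only [sub_self, mul_zero, Real.exp_zero]
      linarith [hexp (1 - x) (by linarith [hx.1])]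
    · have := ((hasDerivAt_id y).sub_const x).const_mul (-α)
      exact this.exp.neg.congr_deriv (by simp [mul_comm])
  · have := Real.exp_le_one_iff.2 (neg_nonpos.2 hα)
    linarith

/-- An integral against the transport kernel of a function bounded by `B`. -/
lemma abs_integral_transportKernel_mul_le {w x B : ℝ} (hw : 0 < w) (hx : x ∈ Icc (0 : ℝ) 1)
    (q : Momentum) {g : ℝ → ℝ} (hB : ∀ y ∈ Icc (0 : ℝ) 1, |g y| ≤ B) :
    |∫ y in Icc (0 : ℝ) 1, transportKernel w x q y * g y| ≤
      (1 - Real.exp (-(w / |q 0|))) * B := by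
  have hB0 : 0 ≤ B := (abs_nonneg _).trans (hB 0 (by simp))
  calc |∫ y in Icc (0 : ℝ) 1, transportKernel w x q y * g y|
      ≤ ∫ y in Icc (0 : ℝ) 1, transportKernel w x q y * B := by
        rw [← Real.norm_eq_abs]
        refine norm_integral_le_of_norm_le ((integrable_transportKernel hw x q).mul_const B) ?_
        filter_upwards [ae_restrict_mem measurableSet_Icc] with y hy
        rw [norm_mul, Real.norm_of_nonneg (transportKernel_nonneg hw x q y)]
        exact mul_le_mul_of_nonneg_left (hB y hy) (transportKernel_nonneg hw x q y)
    _ = (∫ y in Icc (0 : ℝ) 1, transportKernel w x q y) * B := integral_mul_const _ _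
    _ ≤ _ := by gcongr; exact integral_transportKernel_le hw hx q

lemma mildRHS_eq {w x : ℝ} (hx : x ∈ Icc (0 : ℝ) 1) (fL fR : Momentum → ℝ)
    (f : ℝ → Momentum → ℝ) (q : Momentum) :
    mildRHS w fL fR f x q = inflowDamped w fL fR x q +
      ∫ y in Icc (0 : ℝ) 1, transportKernel w x q y * maxwellian (f y) q := by
  rw [integral_transportKernel_mul hx, mildRHS, inflowDamped]
  split_ifs <;> simp

/-! ### Measure-theoretic preliminaries -/

/-- Passing from slices to the product needs a measurable exceptional set, so both functions are
replaced by measurable representatives. -/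
lemma ae_prod_eq_of_ae_ae {X Y : Type*} [MeasurableSpace X] [MeasurableSpace Y] {μ : Measure X}
    {ν : Measure Y} [SFinite ν] {f g : X × Y → ℝ} (hf : AEStronglyMeasurable f (μ.prod ν))
    (hg : AEStronglyMeasurable g (μ.prod ν)) (h : ∀ᵐ x ∂μ, ∀ᵐ y ∂ν, f (x, y) = g (x, y)) :
    f =ᵐ[μ.prod ν] g := by
  refine hf.ae_eq_mk.trans (EventuallyEq.trans ?_ hg.ae_eq_mk.symm)
  have hs : MeasurableSet {z | hf.mk f z = hg.mk g z} :=
    measurableSet_eq_fun hf.stronglyMeasurable_mk.measurable hg.stronglyMeasurable_mk.measurable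
  refine Measure.measure_prod_null_of_ae_null hs.compl ?_
  filter_upwards [h, Measure.ae_ae_of_ae_prod hf.ae_eq_mk, Measure.ae_ae_of_ae_prod hg.ae_eq_mk]
    with x h1 h2 h3
  change ∀ᵐ y ∂ν, hf.mk f (x, y) = hg.mk g (x, y)
  filter_upwards [h1, h2, h3] with y e1 e2 e3
  rw [← e2, e1, e3]

/-- A uniform contraction on the measurable functions with values in a closed bounded set has a
unique fixed point. -/
lemma exists_unique_measurable_fixedPoint {X E : Type*} [MeasurableSpace X] [MetricSpace E]
    [CompleteSpace E] [MeasurableSpace E] [BorelSpace E] {S : Set E} (hS : IsClosed S)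
    {B κ : ℝ} (hB : 0 ≤ B) (hSB : ∀ u ∈ S, ∀ v ∈ S, dist u v ≤ B) (hκ0 : 0 ≤ κ) (hκ1 : κ < 1)
    {T : (X → E) → X → E} {P : (X → E) → Prop} (hP : ∀ m, P m ↔ Measurable m ∧ ∀ x, m x ∈ S)
    (hT : ∀ m, P m → P (T m))
    (hcontr : ∀ m m', P m → P m' → ∀ d, 0 ≤ d → (∀ x, dist (m x) (m' x) ≤ d) →
      ∀ x, dist (T m x) (T m' x) ≤ κ * d) {e : E} (he : e ∈ S) :
    ∃ m, P m ∧ T m = m ∧ ∀ m', P m' → T m' = m' → m' = m := by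
  -- Picard iteration from the constant `e`. The iterates converge geometrically at each point, and
  -- pointwise limits stay measurable, so no function space is needed.
  set u : ℕ → X → E := fun k => T^[k] fun _ => e with hu
  have hus : ∀ k, u (k + 1) = T (u k) := fun k => Function.iterate_succ_apply' T k _
  have hPu : ∀ k, P (u k) := by
    intro k
    induction k with
    | zero => exact (hP _).2 ⟨measurable_const, fun _ => he⟩
    | succ k ih => rw [hus]; exact hT _ ih
  have hmem : ∀ m, P m → ∀ x, m x ∈ S := fun m hm => ((hP m).1 hm).2
  have hstep : ∀ k x, dist (u k x) (u (k + 1) x) ≤ B * κ ^ k := by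
    intro k
    induction k with
    | zero => intro x; simpa using hSB _ (hmem _ (hPu 0) x) _ (hmem _ (hPu 1) x)
    | succ k ih =>
      intro x
      rw [hus (k + 1)]
      nth_rewrite 1 [hus k]
      refine (hcontr _ _ (hPu k) (hPu (k + 1)) _ (by positivity) ih x).trans (le_of_eq ?_)
      ring
  have hlim : ∀ x, ∃ l, Tendsto (fun k => u k x) atTop (𝓝 l) := fun x =>
    cauchySeq_tendsto_of_complete (cauchySeq_of_le_geometric κ B hκ1 fun k => hstep k x)
  choose m hm using hlim
  have hPm : P m := (hP m).2
    ⟨measurable_of_tendsto_metrizable (fun k => ((hP _).1 (hPu k)).1) (tendsto_pi_nhds.2 hm),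
      fun x => hS.mem_of_tendsto (hm x) (.of_forall fun k => hmem _ (hPu k) x)⟩
  have hfix : T m = m := by
    ext x
    refine tendsto_nhds_unique ?_ ((tendsto_add_atTop_iff_nat 1).2 (hm x))
    rw [tendsto_iff_dist_tendsto_zero]
    have hz : Tendsto (fun k : ℕ => κ * (B * κ ^ k / (1 - κ))) atTop (𝓝 0) := by
      have := ((tendsto_pow_atTop_nhds_zero_of_lt_one hκ0 hκ1).const_mul B).div_const (1 - κ)
      simpa using this.const_mul κ
    refine squeeze_zero (fun _ => dist_nonneg) (fun k => ?_) hz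
    rw [hus k]
    have h1 : 0 < 1 - κ := by linarith
    exact hcontr _ _ (hPu k) hPm _ (by positivity) (fun y =>
      dist_le_of_le_geometric_of_tendsto κ B hκ1 (fun k => hstep k y) (hm y) k) x
  refine ⟨m, hPm, hfix, fun m' hPm' hfix' => ?_⟩
  have hd : ∀ k : ℕ, ∀ x, dist (m' x) (m x) ≤ B * κ ^ k := by
    intro k
    induction k with
    | zero => intro x; simpa using hSB _ (hmem _ hPm' x) _ (hmem _ hPm x)
    | succ k ih =>
      intro x
      rw [← hfix', ← hfix]
      refine (hcontr _ _ hPm' hPm _ (by positivity) ih x).trans (le_of_eq ?_)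
      ring
  ext x
  have hz : Tendsto (fun k : ℕ => B * κ ^ k) atTop (𝓝 0) := by
    simpa using (tendsto_pow_atTop_nhds_zero_of_lt_one hκ0 hκ1).const_mul B
  exact dist_le_zero.1 (ge_of_tendsto' hz fun k => hd k x)

lemma exp_damping_le_one {w : ℝ} (hw : 0 ≤ w) (q : Momentum) :
    Real.exp (-(w / |q 0|)) ≤ 1 :=
  Real.exp_le_one_iff.2 (neg_nonpos.2 (by positivity))

lemma measurable_exp_damping (w : ℝ) :
    Measurable fun q : Momentum => Real.exp (-(w / |q 0|)) := by
  have := measurable_apply_zero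
  fun_prop

lemma integrable_exp_damping_mul {w : ℝ} (hw : 0 ≤ w) {F : Momentum → ℝ} (hF : Integrable F) :
    Integrable fun q => Real.exp (-(w / |q 0|)) * F q := by
  refine hF.mono ((measurable_exp_damping w).aestronglyMeasurable.mul hF.1) (.of_forall fun q => ?_)
  rw [norm_mul, Real.norm_of_nonneg (Real.exp_pos _).le]
  exact mul_le_of_le_one_left (norm_nonneg _) (exp_damping_le_one hw q)

/-- Dominated convergence with majorant `|F|`. No rate is claimed, so the singularity of `1/|q₁|`
needs no estimate. -/
lemma tendsto_integral_exp_damping_mul {F : Momentum → ℝ} (hF : Integrable F) :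
    Tendsto (fun w : ℝ => ∫ q, Real.exp (-(w / |q 0|)) * F q) (𝓝[>] 0) (𝓝 (∫ q, F q)) := by
  refine tendsto_integral_filter_of_dominated_convergence (fun q => ‖F q‖) ?_ ?_ hF.norm ?_
  · exact .of_forall fun w => (measurable_exp_damping w).aestronglyMeasurable.mul hF.1
  · filter_upwards [self_mem_nhdsWithin] with w hw
    refine .of_forall fun q => ?_
    rw [norm_mul, Real.norm_of_nonneg (Real.exp_pos _).le]
    exact mul_le_of_le_one_left (norm_nonneg _) (exp_damping_le_one (le_of_lt hw) q)
  · refine .of_forall fun q => ?_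
    have h : Continuous fun w : ℝ => Real.exp (-(w / |q 0|)) * F q := by fun_prop
    have h2 := (h.tendsto 0).mono_left (nhdsWithin_le_nhds (s := Ioi 0))
    simpa using h2

/-! ### Damped inflow -/

/-- The factor by which the inflow is damped at the position `x`. -/
def damping (w x : ℝ) (q : Momentum) : ℝ :=
  -- The value at `q₁ = 0` is immaterial: the inflow vanishes there.
  if 0 < q 0 then Real.exp (-(w / |q 0|) * x) else Real.exp (-(w / |q 0|) * (1 - x))

lemma inflowDamped_eq (w : ℝ) (fL fR : Momentum → ℝ) (x : ℝ) (q : Momentum) :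
    inflowDamped w fL fR x q = damping w x q * inflow fL fR q := by
  unfold inflowDamped damping inflow
  split_ifs <;> simp

lemma measurable_damping (w : ℝ) : Measurable fun p : ℝ × Momentum => damping w p.1 p.2 := by
  have hq : Measurable fun p : ℝ × Momentum => p.2 0 := measurable_apply_zero.comp measurable_snd
  unfold damping
  exact Measurable.ite (measurableSet_lt measurable_const hq) (by fun_prop) (by fun_prop)

lemma damping_le_one {w x : ℝ} (hw : 0 ≤ w) (hx : x ∈ Icc (0 : ℝ) 1) (q : Momentum) :
    damping w x q ≤ 1 := by
  have h0 : 0 ≤ w / |q 0| := by positivity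
  have := hx.1
  have := hx.2
  unfold damping
  split_ifs <;> exact Real.exp_le_one_iff.2 (by nlinarith)

/-- Crossing the whole slab damps most, which makes the lower bounds uniform in `x`. -/
lemma exp_le_damping {w x : ℝ} (hw : 0 ≤ w) (hx : x ∈ Icc (0 : ℝ) 1) (q : Momentum) :
    Real.exp (-(w / |q 0|)) ≤ damping w x q := by
  have h0 : 0 ≤ w / |q 0| := by positivity
  have := hx.1
  have := hx.2
  unfold damping
  split_ifs <;> exact Real.exp_le_exp.2 (by nlinarith)

lemma integrable_inflowDamped {w x : ℝ} {fL fR : Momentum → ℝ} (hint : Integrable (inflow fL fR))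
    (hw : 0 ≤ w) (hx : x ∈ Icc (0 : ℝ) 1) : Integrable (inflowDamped w fL fR x) := by
  have hm : Measurable (damping w x) := (measurable_damping w).comp measurable_prodMk_left
  refine (hint.mono (hm.aestronglyMeasurable.mul hint.1) (.of_forall fun q => ?_)).congr
    (.of_forall fun q => (inflowDamped_eq w fL fR x q).symm)
  have hd : 0 ≤ damping w x q := (Real.exp_pos _).le.trans (exp_le_damping hw hx q)
  simp only [Pi.mul_apply]
  rw [norm_mul, Real.norm_of_nonneg hd]
  exact mul_le_of_le_one_left (norm_nonneg _) (damping_le_one hw hx q)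

section inflow

variable {fL fR : Momentum → ℝ}

lemma exp_mul_inflow_le {w x : ℝ} (hw : 0 ≤ w) (hx : x ∈ Icc (0 : ℝ) 1) {q : Momentum}
    (hq : 0 ≤ inflow fL fR q) :
    Real.exp (-(w / |q 0|)) * inflow fL fR q ≤ inflowDamped w fL fR x q := by
  rw [inflowDamped_eq]
  exact mul_le_mul_of_nonneg_right (exp_le_damping hw hx q) hq

lemma inflowDamped_le {w x : ℝ} (hw : 0 ≤ w) (hx : x ∈ Icc (0 : ℝ) 1) {q : Momentum}
    (hq : 0 ≤ inflow fL fR q) : inflowDamped w fL fR x q ≤ inflow fL fR q := by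
  rw [inflowDamped_eq]
  exact mul_le_of_le_one_left hq (damping_le_one hw hx q)

lemma inflowDamped_nonneg {w x : ℝ} (hw : 0 ≤ w) (hx : x ∈ Icc (0 : ℝ) 1) {q : Momentum}
    (hq : 0 ≤ inflow fL fR q) : 0 ≤ inflowDamped w fL fR x q :=
  (mul_nonneg (Real.exp_pos _).le hq).trans (exp_mul_inflow_le hw hx hq)

lemma aLower_eq (w : ℝ) : aLower w fL fR =
    ∫ q, (Real.exp (-(w / |q 0|)) * inflow fL fR q) * (1 / q0 q ^ 2) := rfl


lemma aLower_le_integral_inflowDamped (hnonneg : ∀ᵐ q : Momentum, 0 ≤ inflow fL fR q)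
    (hint : Integrable (inflow fL fR)) {w x : ℝ} (hw : 0 ≤ w) (hx : x ∈ Icc (0 : ℝ) 1) :
    aLower w fL fR ≤ ∫ q, inflowDamped w fL fR x q * (1 / q0 q ^ 2) := by
  refine integral_mono_ae (integrable_mul_one_div_q0_sq (integrable_exp_damping_mul hw hint))
    (integrable_mul_one_div_q0_sq (integrable_inflowDamped hint hw hx)) ?_
  filter_upwards [hnonneg] with q hq
  have := q0_pos q
  exact mul_le_mul_of_nonneg_right (exp_mul_inflow_le hw hx hq) (by positivity)

end inflow

/-! ### The gain term -/

/-- On `S` the local Maxwellian is non-negative, bounded by a Gibbs factor, and Lipschitz in the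
moments with constant the same Gibbs factor. -/
structure IsGibbsBound (S : Set MomentSpace) (C b : ℝ) : Prop where
  C_pos : 0 < C
  b_pos : 0 < b
  nonneg : ∀ m ∈ S, ∀ q, 0 ≤ gibbs m q
  le : ∀ m ∈ S, ∀ q, gibbs m q ≤ C * Real.exp (-b * q0 q)
  lipschitz : ∀ m ∈ S, ∀ m' ∈ S, ∀ q,
    |gibbs m q - gibbs m' q| ≤ C * dist m m' * Real.exp (-b * q0 q)

/-- Measurable functions of the position with values in `S`. -/
def MeasurableInto (S : Set MomentSpace) (m : ℝ → MomentSpace) : Prop :=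
  Measurable m ∧ ∀ x, m x ∈ S

/-- The gain term of the mild formulation, as a function of the moments. -/
def gain (w : ℝ) (m : ℝ → MomentSpace) (x : ℝ) (q : Momentum) : ℝ :=
  ∫ y in Icc (0 : ℝ) 1, transportKernel w x q y * gibbs (m y) q

/-- A Gibbs factor times the fraction absorbed on the way through the slab. -/
def gainBound (w C b : ℝ) (q : Momentum) : ℝ :=
  (1 - Real.exp (-(w / |q 0|))) * (C * Real.exp (-b * q0 q))

lemma integrable_gainBound {w C b : ℝ} (hw : 0 ≤ w) (hb : 0 < b) :
    Integrable (gainBound w C b) := by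
  have h := (integrable_exp_neg_q0 hb).const_mul C
  refine (h.sub (integrable_exp_damping_mul hw h)).congr (.of_forall fun q => ?_)
  simp only [gainBound, Pi.sub_apply]
  ring

lemma gainBound_le {w C b : ℝ} (hC : 0 ≤ C) (q : Momentum) :
    gainBound w C b q ≤ C * Real.exp (-b * q0 q) :=
  mul_le_of_le_one_left (by positivity) (by linarith [Real.exp_pos (-(w / |q 0|))])

lemma tendsto_integral_gainBound (C : ℝ) {b : ℝ} (hb : 0 < b) :
    Tendsto (fun w => ∫ q, gainBound w C b q) (𝓝[>] 0) (𝓝 0) := by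
  have h := (integrable_exp_neg_q0 hb).const_mul C
  have h1 := (tendsto_integral_exp_damping_mul h).const_sub (∫ q : Momentum, C * Real.exp (-b * q0 q))
  rw [sub_self] at h1
  refine h1.congr' ?_
  filter_upwards [self_mem_nhdsWithin] with w hw
  rw [← integral_sub h (integrable_exp_damping_mul (le_of_lt hw) h)]
  congr 1
  ext q
  simp only [gainBound]
  ring

section gain

variable {S : Set MomentSpace} {C b w x : ℝ} {m m' : ℝ → MomentSpace}

/-- A Carathéodory function: Lipschitz in the moments on `S`, continuous in `q`. The restriction to
`S` matters because the inverse of `K₁/K₂` is a bare choice outside the range. -/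
lemma measurable_gibbs (hG : IsGibbsBound S C b) (hm : MeasurableInto S m) :
    Measurable fun p : ℝ × Momentum => gibbs (m p.1) p.2 := by
  have h : Measurable (Function.uncurry fun (u : S) (q : Momentum) => gibbs u q) := by
    refine measurable_uncurry_of_continuous_of_measurable (fun q => ?_) fun u => ?_
    · refine (LipschitzWith.of_dist_le' (K := C * Real.exp (-b * q0 q)) fun u v => ?_).continuous
      rw [Real.dist_eq]
      refine (hG.lipschitz u u.2 v v.2 q).trans (le_of_eq ?_)
      rw [Subtype.dist_eq]
      ring
    · unfold gibbs
      exact (by fun_prop : Continuous _).measurable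
  exact h.comp (((hm.1.comp measurable_fst).subtype_mk (h := fun p => hm.2 p.1)).prodMk
    measurable_snd)

lemma measurable_gain (hG : IsGibbsBound S C b) (hm : MeasurableInto S m) (w : ℝ) :
    Measurable (Function.uncurry (gain w m)) := by
  refine (StronglyMeasurable.integral_prod_right (ν := volume.restrict (Icc (0 : ℝ) 1))
    (f := fun (p : ℝ × Momentum) y => transportKernel w p.1 p.2 y * gibbs (m y) p.2)
    (Measurable.stronglyMeasurable ?_)).measurable
  exact (measurable_transportKernel w).mul ((measurable_gibbs hG hm).comp
    (measurable_snd.prodMk (measurable_snd.comp measurable_fst)))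

lemma gain_nonneg (hG : IsGibbsBound S C b) (hm : MeasurableInto S m) (hw : 0 < w) (x : ℝ)
    (q : Momentum) : 0 ≤ gain w m x q :=
  integral_nonneg fun y =>
    mul_nonneg (transportKernel_nonneg hw x q y) (hG.nonneg _ (hm.2 y) q)

lemma gain_le (hG : IsGibbsBound S C b) (hm : MeasurableInto S m) (hw : 0 < w)
    (hx : x ∈ Icc (0 : ℝ) 1) (q : Momentum) : gain w m x q ≤ gainBound w C b q := by
  refine (le_abs_self _).trans (abs_integral_transportKernel_mul_le hw hx q fun y _ => ?_)
  rw [abs_of_nonneg (hG.nonneg _ (hm.2 y) q)]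
  exact hG.le _ (hm.2 y) q

lemma integrable_gain (hG : IsGibbsBound S C b) (hm : MeasurableInto S m) (hw : 0 < w)
    (hx : x ∈ Icc (0 : ℝ) 1) : Integrable (gain w m x) := by
  refine (integrable_gainBound (C := C) hw.le hG.b_pos).mono'
    ((measurable_gain hG hm w).comp measurable_prodMk_left).aestronglyMeasurable
    (.of_forall fun q => ?_)
  rw [Real.norm_of_nonneg (gain_nonneg hG hm hw x q)]
  exact gain_le hG hm hw hx q

lemma integrable_transportKernel_mul_gibbs (hG : IsGibbsBound S C b) (hm : MeasurableInto S m)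
    (hw : 0 < w) (x : ℝ) (q : Momentum) :
    Integrable (fun y => transportKernel w x q y * gibbs (m y) q)
      (volume.restrict (Icc 0 1)) := by
  refine (integrable_transportKernel hw x q).mul_bdd (c := C * Real.exp (-b * q0 q))
    ((measurable_gibbs hG hm).comp measurable_prodMk_right).aestronglyMeasurable
    (.of_forall fun y => ?_)
  rw [Real.norm_of_nonneg (hG.nonneg _ (hm.2 y) q)]
  exact hG.le _ (hm.2 y) q

lemma abs_gain_sub_le (hG : IsGibbsBound S C b) (hm : MeasurableInto S m)
    (hm' : MeasurableInto S m') (hw : 0 < w) (hx : x ∈ Icc (0 : ℝ) 1) {d : ℝ}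
    (hd : ∀ y, dist (m y) (m' y) ≤ d) (q : Momentum) :
    |gain w m x q - gain w m' x q| ≤ gainBound w C b q * d := by
  rw [gain, gain, ← integral_sub (integrable_transportKernel_mul_gibbs hG hm hw x q)
    (integrable_transportKernel_mul_gibbs hG hm' hw x q)]
  simp only [← mul_sub]
  refine (abs_integral_transportKernel_mul_le (B := C * d * Real.exp (-b * q0 q)) hw hx q
    fun y _ => ?_).trans (le_of_eq ?_)
  · have := hG.C_pos
    refine (hG.lipschitz _ (hm.2 y) _ (hm'.2 y) q).trans ?_
    gcongr
    exact hd y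
  · rw [gainBound]; ring

/-- The gain sees only the almost-everywhere class of the moments; uniqueness rests on this. -/
lemma gain_congr (h : ∀ᵐ y ∂volume.restrict (Icc (0 : ℝ) 1), m y = m' y) (w x : ℝ) (q : Momentum) :
    gain w m x q = gain w m' x q :=
  integral_congr_ae (by filter_upwards [h] with y hy; rw [hy])

end gain

/-! ### The density profile generated by given moments -/

/-- The right-hand side of the mild formulation, as a function of the moments. -/
def profile (w : ℝ) (fL fR : Momentum → ℝ) (m : ℝ → MomentSpace) (x : ℝ) (q : Momentum) : ℝ :=
  inflowDamped w fL fR x q + gain w m x q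

/-- The map on moments whose fixed points are the moments of mild solutions. -/
def momentMap (w : ℝ) (fL fR : Momentum → ℝ) (m : ℝ → MomentSpace) (x : ℝ) : MomentSpace :=
  -- Clamping `x` to `[0,1]` lets the iteration run over functions on all of `ℝ`, with bounds at
  -- every point.
  moments (profile w fL fR m (projIcc (0 : ℝ) 1 zero_le_one x))

/-- Smallness conditions on `w`. -/
structure IsSmall (fL fR : Momentum → ℝ) (a c C b w : ℝ) : Prop where
  w_pos : 0 < w
  lower : a ≤ aLower w fL fR
  -- `mass` accounts for the factor `2` in `a_u`, `half` is the contraction constant, and `gap` is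
  -- the room between `λ` and `√λ`.
  mass : ∫ q, gainBound w C b q ≤ ∫ q, inflow fL fR q
  half : ∫ q, gainBound w C b q ≤ 1 / 2
  lam_pos : ∀ x ∈ Icc (0 : ℝ) 1, 0 < lam w fL fR x
  lam_le : ∀ x ∈ Icc (0 : ℝ) 1, √(lam w fL fR x) ≤ c
  gap : ∀ x ∈ Icc (0 : ℝ) 1, ∫ q, gainBound w C b q ≤ lam w fL fR x * (1 - c) * a

lemma besselRatio_invTemp {h : Momentum → ℝ} (hh : HasMacroFields h) :
    besselRatio (invTemp h) = ratioMoment h :=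
  (besselRatioInv_spec hh.2).2

lemma ratioMoment_le_iff {h : Momentum → ℝ} (hd : 0 < momDensity (moments h)) (r : ℝ) :
    ratioMoment h ≤ r ↔ (moments h).2.2 ≤ r * momDensity (moments h) := by
  rw [ratioMoment_eq, momRatio, one_div, inv_mul_eq_div, div_le_iff₀ hd]

lemma aestronglyMeasurable_profile {fL fR : Momentum → ℝ} {S : Set MomentSpace} {C b w : ℝ}
    {m : ℝ → MomentSpace} (hint : Integrable (inflow fL fR)) (hG : IsGibbsBound S C b)
    (hm : MeasurableInto S m) (μ : Measure ℝ) [SFinite μ] :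
    AEStronglyMeasurable (Function.uncurry (profile w fL fR m)) (μ.prod volume) := by
  have h1 : AEStronglyMeasurable (fun p : ℝ × Momentum => damping w p.1 p.2 * inflow fL fR p.2)
      (μ.prod volume) := (measurable_damping w).aestronglyMeasurable.mul hint.1.comp_snd
  refine (h1.add (measurable_gain hG hm w).aestronglyMeasurable).congr (.of_forall fun p => ?_)
  simp only [Pi.add_apply, Function.uncurry, profile, inflowDamped_eq]

/-- Replacing the inflow by a measurable representative leaves all moments unchanged, so the result
is measurable and not merely almost everywhere so. -/
lemma measurable_momentMap {fL fR : Momentum → ℝ} {S : Set MomentSpace} {C b w : ℝ}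
    {m : ℝ → MomentSpace} (hint : Integrable (inflow fL fR)) (hG : IsGibbsBound S C b)
    (hm : MeasurableInto S m) : Measurable (momentMap w fL fR m) := by
  have h1 : Measurable (Function.uncurry fun x q =>
      damping w x q * hint.1.mk (inflow fL fR) q + gain w m x q) :=
    ((measurable_damping w).mul (hint.1.stronglyMeasurable_mk.measurable.comp
      measurable_snd)).add (measurable_gain hG hm w)
  have h2 := (measurable_moments h1).comp
    (measurable_subtype_coe.comp (continuous_projIcc (h := zero_le_one (α := ℝ))).measurable)
  have e : momentMap w fL fR m = (fun x => moments fun q =>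
      damping w x q * hint.1.mk (inflow fL fR) q + gain w m x q) ∘
      (Subtype.val ∘ projIcc (0 : ℝ) 1 zero_le_one) := by
    ext1 x
    refine moments_congr ?_
    filter_upwards [hint.1.ae_eq_mk] with q hq
    rw [profile, inflowDamped_eq, hq]
    rfl
  rw [e]
  exact h2

section profile

variable {fL fR : Momentum → ℝ} {a c C b w x : ℝ} {m m' : ℝ → MomentSpace}

lemma integrable_profile {S : Set MomentSpace} (hint : Integrable (inflow fL fR))
    (hG : IsGibbsBound S C b) (hm : MeasurableInto S m) (hw : 0 < w) (hx : x ∈ Icc (0 : ℝ) 1) :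
    Integrable (profile w fL fR m x) :=
  (integrable_inflowDamped hint hw.le hx).add (integrable_gain hG hm hw hx)

lemma profile_nonneg {S : Set MomentSpace} (hG : IsGibbsBound S C b) (hm : MeasurableInto S m)
    (hw : 0 < w) (hx : x ∈ Icc (0 : ℝ) 1) {q : Momentum} (hq : 0 ≤ inflow fL fR q) :
    0 ≤ profile w fL fR m x q :=
  add_nonneg (inflowDamped_nonneg hw.le hx hq) (gain_nonneg hG hm hw x q)

lemma integrable_uncurry_profile {S : Set MomentSpace}
    (hnonneg : ∀ᵐ q : Momentum, 0 ≤ inflow fL fR q) (hint : Integrable (inflow fL fR))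
    (hG : IsGibbsBound S C b) (hm : MeasurableInto S m) (hw : 0 < w) :
    Integrable (Function.uncurry (profile w fL fR m)) slab := by
  have hbd : Integrable (fun q : Momentum => inflow fL fR q + C * Real.exp (-b * q0 q)) :=
    hint.add ((integrable_exp_neg_q0 hG.b_pos).const_mul C)
  refine (hbd.comp_snd (volume.restrict (Icc (0 : ℝ) 1))).mono'
    (aestronglyMeasurable_profile hint hG hm _) ?_
  have h1 : ∀ᵐ z ∂slab, z.1 ∈ Icc (0 : ℝ) 1 :=
    Measure.quasiMeasurePreserving_fst.ae (ae_restrict_mem measurableSet_Icc)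
  have h2 : ∀ᵐ z ∂slab, 0 ≤ inflow fL fR z.2 := Measure.quasiMeasurePreserving_snd.ae hnonneg
  filter_upwards [h1, h2] with z hz hq
  have h3 := profile_nonneg hG hm hw hz hq
  rw [Function.uncurry, Real.norm_of_nonneg h3]
  exact add_le_add (inflowDamped_le hw.le hz hq)
    ((gain_le hG hm hw hz _).trans (gainBound_le hG.C_pos.le _))

/-- The profile generated by admissible moments satisfies all three bounds. -/
lemma profile_bounds {S : Set MomentSpace} (hnonneg : ∀ᵐ q : Momentum, 0 ≤ inflow fL fR q)
    (hint : Integrable (inflow fL fR)) (ha : 0 < a) (hc : c < 1) (hG : IsGibbsBound S C b)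
    (hs : IsSmall fL fR a c C b w) (hm : MeasurableInto S m) (hx : x ∈ Icc (0 : ℝ) 1) :
    moments (profile w fL fR m x) ∈ momentSet a (aUpper fL fR) c ∧
      HasMacroFields (profile w fL fR m x) ∧ BoundsAt w fL fR (profile w fL fR m) x := by
  have hw := hs.w_pos
  have hDi := integrable_inflowDamped hint hw.le hx
  have hgi := integrable_gain hG hm hw hx
  have hhi := integrable_profile hint hG hm hw hx
  have hD0 : 0 ≤ᵐ[volume] inflowDamped w fL fR x := by
    filter_upwards [hnonneg] with q hq
    exact inflowDamped_nonneg hw.le hx hq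
  have hh0 : 0 ≤ᵐ[volume] profile w fL fR m x := by
    filter_upwards [hnonneg] with q hq
    exact profile_nonneg hG hm hw hx hq
  have hg0 := gain_nonneg hG hm hw x
  have hDh : ∀ q, inflowDamped w fL fR x q ≤ profile w fL fR m x q := fun q => by
    rw [profile]; linarith [hg0 q]
  have hgm : ∫ q, gain w m x q ≤ ∫ q, gainBound w C b q :=
    integral_mono hgi (integrable_gainBound hw.le hG.b_pos) (gain_le hG hm hw hx)
  set κ := ∫ q, gainBound w C b q
  set h := profile w fL fR m x with hh
  -- moments of the damped inflow and of the profile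
  have d02 := integral_one_div_q0_sq_le hDi hD0
  have d01 := integral_one_div_q0_le hDi hD0
  have h02 := integral_one_div_q0_sq_le hhi hh0
  have hlow : aLower w fL fR ≤ ∫ q, inflowDamped w fL fR x q * (1 / q0 q ^ 2) :=
    aLower_le_integral_inflowDamped hnonneg hint hw.le hx
  have m2 : ∫ q, inflowDamped w fL fR x q * (1 / q0 q ^ 2) ≤ ∫ q, h q * (1 / q0 q ^ 2) :=
    integral_mono (integrable_mul_one_div_q0_sq hDi) (integrable_mul_one_div_q0_sq hhi) fun q => by
      have := q0_pos q
      exact mul_le_mul_of_nonneg_right (hDh q) (by positivity)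
  have m0 : ∫ q, inflowDamped w fL fR x q ≤ ∫ q, h q := integral_mono hDi hhi hDh
  have u0 : ∫ q, h q ≤ aUpper fL fR := by
    have e : ∫ q, h q = (∫ q, inflowDamped w fL fR x q) + ∫ q, gain w m x q :=
      integral_add hDi hgi
    have h1 : ∫ q, inflowDamped w fL fR x q ≤ ∫ q, inflow fL fR q :=
      integral_mono_ae hDi hint (by
        filter_upwards [hnonneg] with q hq
        exact inflowDamped_le hw.le hx hq)
    rw [aUpper, e]
    linarith [hs.mass]
  have u1 : ∫ q, h q * (1 / q0 q) ≤ (∫ q, inflowDamped w fL fR x q * (1 / q0 q)) + κ := by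
    have e : ∫ q, h q * (1 / q0 q) = (∫ q, inflowDamped w fL fR x q * (1 / q0 q)) +
        ∫ q, gain w m x q * (1 / q0 q) := by
      rw [← integral_add (integrable_mul_one_div_q0 hDi) (integrable_mul_one_div_q0 hgi)]
      congr 1
      ext q
      rw [hh, profile, add_mul]
    have h1 := integral_one_div_q0_le hgi (.of_forall hg0)
    rw [e]
    linarith
  set D0 := ∫ q, inflowDamped w fL fR x q
  set D1 := ∫ q, inflowDamped w fL fR x q * (1 / q0 q)
  set D2 := ∫ q, inflowDamped w fL fR x q * (1 / q0 q ^ 2)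
  have hal := hs.lower
  have hN : a ≤ √(D0 * D2) := by
    apply Real.le_sqrt_of_sq_le
    rw [sq]
    exact mul_le_mul (by linarith) (by linarith) ha.le (by linarith)
  have hn : √(D0 * D2) ≤ momDensity (moments h) :=
    (Real.sqrt_le_sqrt (mul_le_mul m0 m2 (by linarith) (by linarith))).trans
      (sqrt_le_momDensity hhi hh0)
  have hnpos : 0 < momDensity (moments h) := by linarith
  have hlam : lam w fL fR x * √(D0 * D2) = D1 := by
    have : √(D0 * D2) ≠ 0 := by linarith
    change D1 / √(D0 * D2) * √(D0 * D2) = D1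
    field_simp
  have hl0 := hs.lam_pos x hx
  have hl1 := hs.lam_le x hx
  have hgap := hs.gap x hx
  set l := lam w fL fR x
  have hsq := Real.sq_sqrt hl0.le
  have hsp := Real.sqrt_pos.2 hl0
  set r := √l
  -- Write `r = √λ`, `N = √(D0 D2)`. Then `S ≤ λN + κ` and `κ ≤ λ(1-r)N ≤ r(1-r)N`, and `λ + r(1-r)
  -- = r` because `λ = r²`; finally `N ≤ n`.
  have key : (moments h).2.2 ≤ r * momDensity (moments h) := by
    change ∫ q, h q * (1 / q0 q) ≤ _
    have t1 : κ ≤ l * (1 - r) * √(D0 * D2) := by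
      refine hgap.trans (mul_le_mul ?_ hN ha.le (mul_nonneg hl0.le (by linarith)))
      exact mul_le_mul_of_nonneg_left (by linarith) hl0.le
    have t2 : l * (1 - r) ≤ r * (1 - r) := by
      have : l ≤ r := by nlinarith
      exact mul_le_mul_of_nonneg_right this (by linarith)
    have t3 : l + l * (1 - r) ≤ r := by nlinarith
    calc ∫ q, h q * (1 / q0 q) ≤ (l + l * (1 - r)) * √(D0 * D2) := by linarith
      _ ≤ r * √(D0 * D2) := by gcongr
      _ ≤ r * momDensity (moments h) := by gcongr
  have hs2 : a ≤ (moments h).2.2 := by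
    change a ≤ ∫ q, h q * (1 / q0 q)
    linarith
  have hfields : HasMacroFields h := by
    refine ⟨hnpos, exists_besselRatio_eq ?_ ?_⟩
    · rw [ratioMoment_eq, momRatio]
      have : 0 < (moments h).2.2 := by linarith
      positivity
    · exact ((ratioMoment_le_iff hnpos r).2 key).trans_lt (by linarith)
  refine ⟨⟨?_, u0, hs2, ?_⟩, hfields, ?_, u0, ?_⟩
  · change 0 ≤ ∫ q, h q
    linarith
  · exact key.trans (mul_le_mul_of_nonneg_right hl1 hnpos.le)
  · exact hlow.trans m2
  · change besselRatio (invTemp h) ≤ r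
    rw [besselRatio_invTemp hfields]
    exact (ratioMoment_le_iff hnpos r).2 key

/-- The inflow cancels in the difference, leaving only the gain. -/
lemma dist_momentMap_le {S : Set MomentSpace} (hint : Integrable (inflow fL fR))
    (hG : IsGibbsBound S C b) (hw : 0 < w) (hm : MeasurableInto S m) (hm' : MeasurableInto S m')
    {d : ℝ} (hd : ∀ y, dist (m y) (m' y) ≤ d) (x : ℝ) :
    dist (momentMap w fL fR m x) (momentMap w fL fR m' x) ≤ (∫ q, gainBound w C b q) * d := by
  have hx := (projIcc (0 : ℝ) 1 zero_le_one x).2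
  have h1 := integrable_profile hint hG hm hw hx
  have h2 := integrable_profile hint hG hm' hw hx
  refine (dist_moments_le h1 h2).trans ?_
  rw [← integral_mul_const]
  refine integral_mono (h1.sub h2).abs ((integrable_gainBound hw.le hG.b_pos).mul_const d)
    fun q => ?_
  simp only [profile, add_sub_add_left_eq_sub]
  exact abs_gain_sub_le hG hm hm' hw hx hd q

end profile

/-! ### Small collision frequencies -/

section small

variable {fL fR : Momentum → ℝ}

lemma integrable_aLower (hint : Integrable (inflow fL fR)) {w : ℝ} (hw : 0 ≤ w) :
    Integrable fun q => (Real.exp (-(w / |q 0|)) * inflow fL fR q) * (1 / q0 q ^ 2) :=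
  integrable_mul_one_div_q0_sq (integrable_exp_damping_mul hw hint)

lemma aLower_anti (hnonneg : ∀ᵐ q : Momentum, 0 ≤ inflow fL fR q)
    (hint : Integrable (inflow fL fR)) {w w' : ℝ} (hw : 0 ≤ w) (hww' : w ≤ w') :
    aLower w' fL fR ≤ aLower w fL fR := by
  refine integral_mono_ae (integrable_aLower hint (hw.trans hww')) (integrable_aLower hint hw) ?_
  filter_upwards [hnonneg] with q hq
  have := q0_pos q
  gcongr

/-- Positivity of `aLower` does not depend on `w`. -/
lemma aLower_pos (hnonneg : ∀ᵐ q : Momentum, 0 ≤ inflow fL fR q)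
    (hint : Integrable (inflow fL fR)) {w w' : ℝ} (h : 0 < aLower w fL fR) (hw' : 0 ≤ w') :
    0 < aLower w' fL fR := by
  have hnn : 0 ≤ᵐ[volume] fun q =>
      (Real.exp (-(w' / |q 0|)) * inflow fL fR q) * (1 / q0 q ^ 2) := by
    filter_upwards [hnonneg] with q hq
    have := q0_pos q
    simp only [Pi.zero_apply]
    positivity
  refine lt_of_le_of_ne (integral_nonneg_of_ae hnn) fun h0 => h.ne' ?_
  have hz := (integral_eq_zero_iff_of_nonneg_ae hnn (integrable_aLower hint hw')).1 h0.symm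
  refine integral_eq_zero_of_ae ?_
  filter_upwards [hz] with q hq
  have h1 : inflow fL fR q = 0 := by
    have hq0 := (q0_pos q).ne'
    simpa [hq0] using hq
  simp [h1]

lemma aLower_zero : aLower 0 fL fR = ∫ q, inflow fL fR q * (1 / q0 q ^ 2) := by
  simp [aLower]

/-- The ratio `c < 1` below which the temperature ratio can be kept for all small `w`. -/
lemma exists_ratio_eventually_isSmall (hnonneg : ∀ᵐ q : Momentum, 0 ≤ inflow fL fR q)
    (hint : Integrable (inflow fL fR)) (hpos : 0 < aLower 1 fL fR) :
    ∃ c : ℝ, c < 1 ∧ moments (inflow fL fR) ∈ momentSet (aLower 1 fL fR) (aUpper fL fR) c ∧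
      ∀ C b : ℝ, 0 < C → 0 < b →
        ∀ᶠ w in 𝓝[>] 0, IsSmall fL fR (aLower 1 fL fR) c C b w := by
  have s12 := integral_one_div_q0_sq_le hint hnonneg
  have s01 := integral_one_div_q0_le hint hnonneg
  have ha2 : aLower 1 fL fR ≤ ∫ q, inflow fL fR q * (1 / q0 q ^ 2) := by
    rw [← aLower_zero]
    exact aLower_anti hnonneg hint le_rfl zero_le_one
  have hcs := sq_integral_one_div_q0_lt hint hnonneg (by linarith)
  have hnW := sqrt_le_momDensity hint hnonneg
  have htB := tendsto_integral_exp_damping_mul hint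
  have htA : Tendsto (fun w => aLower w fL fR) (𝓝[>] 0)
      (𝓝 (∫ q, inflow fL fR q * (1 / q0 q ^ 2))) := by
    refine (tendsto_integral_exp_damping_mul (integrable_mul_one_div_q0_sq hint)).congr fun w => ?_
    simp only [aLower_eq, mul_assoc]
  set a := aLower 1 fL fR
  set I := ∫ q, inflow fL fR q with hI
  set S₁ := ∫ q, inflow fL fR q * (1 / q0 q)
  set S₂ := ∫ q, inflow fL fR q * (1 / q0 q ^ 2)
  have hI0 : 0 < I := by linarith
  have hS2 : 0 < S₂ := by linarith
  have hN : 0 < √(I * S₂) := Real.sqrt_pos.2 (by positivity)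
  set l := S₁ / √(I * S₂) with hl
  have hl0 : 0 < l := div_pos (by linarith) hN
  have hl1 : l < 1 := by
    rw [hl, div_lt_one hN]
    exact Real.lt_sqrt_of_sq_lt hcs
  -- `l` is `λ` without damping, and `l < 1` by strict Cauchy–Schwarz. The midpoint `(1+l)/2` leaves
  -- room for `λ(x)` to exceed `l` slightly, and `c` is its square root.
  have hc1 : √((1 + l) / 2) < 1 := by
    rw [Real.sqrt_lt' one_pos]
    linarith
  have hlc : l ≤ √((1 + l) / 2) := Real.le_sqrt_of_sq_le (by nlinarith)
  set c := √((1 + l) / 2)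
  refine ⟨c, hc1, ⟨hI0.le, ?_, ?_, ?_⟩, fun C b hC hb => ?_⟩
  · change I ≤ 2 * I
    linarith
  · exact ha2.trans s12
  · change S₁ ≤ _
    have : S₁ = l * √(I * S₂) := by rw [hl]; field_simp
    rw [this]
    exact mul_le_mul hlc hnW hN.le (Real.sqrt_nonneg _)
  have hκ := tendsto_integral_gainBound C hb
  -- A majorant of `λ(x)` that does not involve `x`: undamped numerator over fully damped
  -- denominator.
  have htl : Tendsto (fun w => S₁ / √((∫ q, Real.exp (-(w / |q 0|)) * inflow fL fR q) *
      aLower w fL fR)) (𝓝[>] 0) (𝓝 l) :=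
    tendsto_const_nhds.div ((htB.mul htA).sqrt) hN.ne'
  -- Since `D1 ≥ D2 ≥ a` and `√(D0 D2) ≤ I`, one has `λ(x) ≥ a/I`, which makes the gap condition
  -- uniform in `x`.
  have hgap : 0 < a / I * (1 - c) * a := by
    have : 0 < 1 - c := by linarith
    positivity
  filter_upwards [self_mem_nhdsWithin, Ioo_mem_nhdsGT (zero_lt_one' ℝ), hκ.eventually_le_const hI0,
    hκ.eventually_le_const (half_pos one_pos), hκ.eventually_le_const hgap,
    htl.eventually_le_const (show l < (1 + l) / 2 by linarith)] with w hw hw1 k1 k2 k3 k4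
  have hw0 : 0 < w := hw
  have hal : a ≤ aLower w fL fR := aLower_anti hnonneg hint hw0.le hw1.2.le
  have main : ∀ x ∈ Icc (0 : ℝ) 1, a / I ≤ lam w fL fR x ∧ lam w fL fR x ≤ (1 + l) / 2 := by
    intro x hx
    have hDi := integrable_inflowDamped hint hw0.le hx
    have hD0 : 0 ≤ᵐ[volume] inflowDamped w fL fR x := by
      filter_upwards [hnonneg] with q hq
      exact inflowDamped_nonneg hw0.le hx hq
    have d02 := integral_one_div_q0_sq_le hDi hD0
    have d01 := integral_one_div_q0_le hDi hD0
    have hlow : aLower w fL fR ≤ ∫ q, inflowDamped w fL fR x q * (1 / q0 q ^ 2) :=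
      aLower_le_integral_inflowDamped hnonneg hint hw0.le hx
    have e0 : ∫ q, inflowDamped w fL fR x q ≤ I := integral_mono_ae hDi hint (by
      filter_upwards [hnonneg] with q hq
      exact inflowDamped_le hw0.le hx hq)
    have e1 : ∫ q, inflowDamped w fL fR x q * (1 / q0 q) ≤ S₁ :=
      integral_mono_ae (integrable_mul_one_div_q0 hDi) (integrable_mul_one_div_q0 hint) (by
        filter_upwards [hnonneg] with q hq
        have := q0_pos q
        exact mul_le_mul_of_nonneg_right (inflowDamped_le hw0.le hx hq) (by positivity))
    have e2 : ∫ q, Real.exp (-(w / |q 0|)) * inflow fL fR q ≤ ∫ q, inflowDamped w fL fR x q :=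
      integral_mono_ae (integrable_exp_damping_mul hw0.le hint) hDi (by
        filter_upwards [hnonneg] with q hq
        exact exp_mul_inflow_le hw0.le hx hq)
    have e3 : aLower w fL fR ≤ ∫ q, Real.exp (-(w / |q 0|)) * inflow fL fR q := by
      have hi := integrable_exp_damping_mul hw0.le hint
      have hn : 0 ≤ᵐ[volume] fun q => Real.exp (-(w / |q 0|)) * inflow fL fR q := by
        filter_upwards [hnonneg] with q hq
        simp only [Pi.zero_apply]
        positivity
      exact (integral_one_div_q0_sq_le hi hn).trans (integral_one_div_q0_le hi hn)
    rw [lam]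
    set D0 := ∫ q, inflowDamped w fL fR x q
    set D1 := ∫ q, inflowDamped w fL fR x q * (1 / q0 q)
    set D2 := ∫ q, inflowDamped w fL fR x q * (1 / q0 q ^ 2)
    have hE : 0 < √((∫ q, Real.exp (-(w / |q 0|)) * inflow fL fR q) * aLower w fL fR) :=
      Real.sqrt_pos.2 (mul_pos (by linarith) (by linarith))
    have hle : √((∫ q, Real.exp (-(w / |q 0|)) * inflow fL fR q) * aLower w fL fR) ≤
        √(D0 * D2) :=
      Real.sqrt_le_sqrt (mul_le_mul e2 hlow (by linarith) (by linarith))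
    have hDI : √(D0 * D2) ≤ I := by
      refine Real.sqrt_le_iff.2 ⟨hI0.le, ?_⟩
      rw [sq]
      exact mul_le_mul e0 (by linarith) (by linarith) hI0.le
    constructor
    · exact div_le_div₀ (by linarith) (by linarith) (by linarith) hDI
    · exact (div_le_div₀ (by linarith) e1 hE hle).trans k4
  have haI : 0 < a / I := by positivity
  refine ⟨hw0, hal, k1, k2, fun x hx => haI.trans_le (main x hx).1,
    fun x hx => Real.sqrt_le_sqrt (main x hx).2, fun x hx => k3.trans ?_⟩
  have h1 := (main x hx).1
  have : 0 ≤ 1 - c := by linarith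
  gcongr

end small

/-! ### Existence and uniqueness -/

lemma dist_le_of_mem_momentSet {a A c : ℝ} (ha : 0 < a) (hc : c < 1) {u v : MomentSpace}
    (hu : u ∈ momentSet a A c) (hv : v ∈ momentSet a A c) : dist u v ≤ 2 * A := by
  have hs : ∀ m ∈ momentSet a A c, m.2.2 ≤ A := fun m hm => by
    have h0 := ha.trans_le (le_momDensity hc hm)
    have h1 := (momDensity_le hm.1).trans hm.2.1
    have h2 := hm.2.2.2
    nlinarith
  have hA : 0 ≤ A := hu.1.trans hu.2.1
  rw [Prod.dist_eq, Prod.dist_eq]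
  refine max_le ?_ (max_le ((dist_pi_le_iff (by positivity)).2 fun i => ?_) ?_) <;>
    rw [Real.dist_eq, abs_le]
  · constructor <;> linarith [hu.1, hu.2.1, hv.1, hv.2.1]
  · have h1 := abs_le.1 (abs_flux_le ha hc hu i)
    have h2 := abs_le.1 (abs_flux_le ha hc hv i)
    constructor <;> linarith
  · constructor <;> linarith [hs u hu, hs v hv, hu.2.2.1, hv.2.2.1]

/-- Each part of `(*)` supplies a condition of the set; for the lower one, `a ≤ a_l ≤ ∫ g/q₀² ≤ ∫
g/q₀`. -/
lemma moments_mem_of_boundsAt {fL fR : Momentum → ℝ} {a c C b w x : ℝ} {g : ℝ → Momentum → ℝ}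
    (hs : IsSmall fL fR a c C b w) (hx : x ∈ Icc (0 : ℝ) 1) (hg : IsMildAt w fL fR g x)
    (hb : BoundsAt w fL fR g x) : moments (g x) ∈ momentSet a (aUpper fL fR) c := by
  have h1 := integral_one_div_q0_sq_le hg.integrable hg.nonneg
  have h2 := hs.lower
  have h3 := hb.lower
  have hd : 0 < momDensity (moments (g x)) := hg.fields.1
  refine ⟨integral_nonneg_of_ae hg.nonneg, hb.upper, ?_, ?_⟩
  · change a ≤ ∫ q, g x q * (1 / q0 q)
    linarith
  · have h4 := hb.ratio
    rw [besselRatio_invTemp hg.fields] at h4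
    exact (ratioMoment_le_iff hd c).1 (h4.trans (hs.lam_le x hx))

lemma mildRHS_eq_profile {fL fR : Momentum → ℝ} {w x : ℝ} {g : ℝ → Momentum → ℝ}
    {m : ℝ → MomentSpace} (hx : x ∈ Icc (0 : ℝ) 1)
    (hm : ∀ᵐ y ∂volume.restrict (Icc (0 : ℝ) 1), moments (g y) = m y) (q : Momentum) :
    mildRHS w fL fR g x q = profile w fL fR m x q := by
  rw [mildRHS_eq hx, profile, ← gain_congr hm]
  -- The Maxwellian of `g y` is by definition the Gibbs function of its moments.
  rfl

/-- The profile generated by the fixed point is a solution; conversely, a competitor is almost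
everywhere the profile generated by its own moments. -/
lemma exists_unique_mildSolution {fL fR : Momentum → ℝ} {a c C b w : ℝ}
    (hnonneg : ∀ᵐ q : Momentum, 0 ≤ inflow fL fR q) (hint : Integrable (inflow fL fR))
    (ha : 0 < a) (hc : c < 1) (hne : (momentSet a (aUpper fL fR) c).Nonempty)
    (hG : IsGibbsBound (momentSet a (aUpper fL fR) c) C b) (hs : IsSmall fL fR a c C b w) :
    ∃ f : ℝ → Momentum → ℝ, IsMildSolution w fL fR f ∧
      (∀ x ∈ Icc (0 : ℝ) 1, IsMildAt w fL fR f x ∧ BoundsAt w fL fR f x) ∧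
      ∀ g : ℝ → Momentum → ℝ, IsMildSolution w fL fR g →
        (∀ᵐ x ∂volume.restrict (Icc (0 : ℝ) 1), BoundsAt w fL fR g x) →
        ∀ᵐ z ∂slab, g z.1 z.2 = f z.1 z.2 := by
  have hw := hs.w_pos
  obtain ⟨e, he⟩ := hne
  have hA : 0 ≤ aUpper fL fR := he.1.trans he.2.1
  have hmaps : ∀ m, MeasurableInto (momentSet a (aUpper fL fR) c) m →
      MeasurableInto (momentSet a (aUpper fL fR) c) (momentMap w fL fR m) := fun m hm =>
    ⟨measurable_momentMap hint hG hm, fun x =>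
      (profile_bounds hnonneg hint ha hc hG hs hm (projIcc (0 : ℝ) 1 zero_le_one x).2).1⟩
  obtain ⟨m, hm, hfix, huniq⟩ := exists_unique_measurable_fixedPoint
    (P := MeasurableInto (momentSet a (aUpper fL fR) c)) (T := momentMap w fL fR) (κ := 1 / 2)
    (isClosed_momentSet a (aUpper fL fR) c) (B := 2 * aUpper fL fR) (by positivity)
    (fun u hu v hv => dist_le_of_mem_momentSet ha hc hu hv) (by norm_num) (by norm_num)
    (fun _ => Iff.rfl) hmaps
    (fun m m' hm hm' d hd0 hd x => (dist_momentMap_le hint hG hw hm hm' hd x).trans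
      (mul_le_mul_of_nonneg_right hs.half hd0)) he
  have hmap : ∀ m, ∀ x ∈ Icc (0 : ℝ) 1,
      momentMap w fL fR m x = moments (profile w fL fR m x) := fun m x hx => by
    rw [momentMap, projIcc_of_mem zero_le_one hx]
  have hmom : ∀ x ∈ Icc (0 : ℝ) 1, moments (profile w fL fR m x) = m x := fun x hx => by
    rw [← hmap m x hx, hfix]
  have hmomae : ∀ᵐ y ∂volume.restrict (Icc (0 : ℝ) 1), moments (profile w fL fR m y) = m y := by
    filter_upwards [ae_restrict_mem measurableSet_Icc] with y hy using hmom y hy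
  have hpt : ∀ x ∈ Icc (0 : ℝ) 1, IsMildAt w fL fR (profile w fL fR m) x ∧
      BoundsAt w fL fR (profile w fL fR m) x := by
    intro x hx
    obtain ⟨-, hf, hb⟩ := profile_bounds hnonneg hint ha hc hG hs hm hx
    refine ⟨⟨integrable_profile hint hG hm hw hx, ?_, hf,
      .of_forall fun q => (mildRHS_eq_profile hx hmomae q).symm⟩, hb⟩
    filter_upwards [hnonneg] with q hq
    exact profile_nonneg hG hm hw hx hq
  refine ⟨profile w fL fR m, ⟨integrable_uncurry_profile hnonneg hint hG hm hw, ?_⟩, hpt,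
    fun g hg hgb => ?_⟩
  · filter_upwards [ae_restrict_mem measurableSet_Icc] with x hx using (hpt x hx).1
  have hgm : ∀ᵐ x ∂volume.restrict (Icc (0 : ℝ) 1),
      moments (g x) ∈ momentSet a (aUpper fL fR) c := by
    filter_upwards [ae_restrict_mem measurableSet_Icc, hg.mild, hgb] with x hx h1 h2
    exact moments_mem_of_boundsAt hs hx h1 h2
  -- A measurable version of the competitor's moments with values in the set at every point, so that
  -- the fixed-point theorem can apply.
  obtain ⟨m₁, hm₁, hr, hgm₁⟩ := (aemeasurable_moments hg.integrable.1).exists_ae_eq_range_subset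
    hgm ⟨e, he⟩
  have hm₁' : MeasurableInto (momentSet a (aUpper fL fR) c) m₁ :=
    ⟨hm₁, fun x => hr (mem_range_self x)⟩
  have hgprof : ∀ᵐ x ∂volume.restrict (Icc (0 : ℝ) 1), g x =ᵐ[volume] profile w fL fR m₁ x := by
    filter_upwards [ae_restrict_mem measurableSet_Icc, hg.mild] with x hx h1
    filter_upwards [h1.eq_mild] with q hq
    rw [hq, mildRHS_eq_profile hx hgm₁]
  have hm₁T : ∀ᵐ x ∂volume.restrict (Icc (0 : ℝ) 1), m₁ x = momentMap w fL fR m₁ x := by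
    filter_upwards [ae_restrict_mem measurableSet_Icc, hgprof, hgm₁] with x hx h1 h2
    rw [← h2, hmap m₁ x hx, moments_congr h1]
  -- `m₁` is a fixed point only almost everywhere, but the profile ignores null sets; hence the
  -- image of `m₁` under the moment map is an exact fixed point.
  have hprof : profile w fL fR (momentMap w fL fR m₁) = profile w fL fR m₁ := by
    ext x q
    rw [profile, profile, gain_congr hm₁T]
  have hTm₁ : momentMap w fL fR m₁ = m := by
    refine huniq _ (hmaps _ hm₁') ?_
    ext1 x
    rw [momentMap, hprof, momentMap]
  rw [hTm₁] at hprof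
  refine ae_prod_eq_of_ae_ae (f := fun z => g z.1 z.2) (g := fun z => profile w fL fR m z.1 z.2)
    hg.integrable.1 (aestronglyMeasurable_profile hint hG hm _) ?_
  rw [hprof]
  exact hgprof

end MarleBGK

end

/-- Positivity of `a_l` does not depend on the choice of `w > 0`, so `hal` asks for it at some
`w > 0` only. The solution is unique as an element of `L¹([0,1] × ℝ³)`; its representative `f`
satisfies the mild formulation and the bounds at every (not just almost every) `x ∈ [0,1]`. -/
theorem theorem1p2 (fL fR : MarleBGK.Momentum → ℝ)
    (hnonneg : ∀ᵐ q : MarleBGK.Momentum, 0 ≤ MarleBGK.inflow fL fR q)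
    (hint : Integrable (MarleBGK.inflow fL fR))
    (hal : ∃ w : ℝ, 0 < w ∧ 0 < MarleBGK.aLower w fL fR) :
    ∃ ε : ℝ, 0 < ε ∧ ∀ w : ℝ, 0 < w → w < ε →
      ∃ f : ℝ → MarleBGK.Momentum → ℝ,
        MarleBGK.IsMildSolution w fL fR f ∧
        (∀ x ∈ Icc (0 : ℝ) 1,
          MarleBGK.IsMildAt w fL fR f x ∧ MarleBGK.BoundsAt w fL fR f x) ∧
        ∀ g : ℝ → MarleBGK.Momentum → ℝ,
          MarleBGK.IsMildSolution w fL fR g →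
          (∀ᵐ x ∂volume.restrict (Icc (0 : ℝ) 1), MarleBGK.BoundsAt w fL fR g x) →
          ∀ᵐ z ∂MarleBGK.slab, g z.1 z.2 = f z.1 z.2 := by
  obtain ⟨w₀, -, hw₀⟩ := hal
  -- The reference value `a = a_l` at `w = 1` bounds `a_l` from below for all `w ≤ 1`. The moment
  -- set and the constants `C`, `b` are thus fixed before `w`, and `ε` depends only on the data.
  have ha := MarleBGK.aLower_pos hnonneg hint hw₀ zero_le_one
  obtain ⟨c, hc, hmem, hsmall⟩ :=
    MarleBGK.exists_ratio_eventually_isSmall hnonneg hint ha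
  have hA : 0 < MarleBGK.aUpper fL fR :=
    ((ha.trans_le (MarleBGK.le_momDensity hc hmem)).trans_le
      (MarleBGK.momDensity_le hmem.1)).trans_le hmem.2.1
  obtain ⟨C, b, hC, hb, h1, h2⟩ := MarleBGK.exists_gibbs_bounds ha hA hc
  have hG : MarleBGK.IsGibbsBound
      (MarleBGK.momentSet (MarleBGK.aLower 1 fL fR) (MarleBGK.aUpper fL fR) c) C b :=
    ⟨hC, hb, fun m hm q => (h1 m hm q).1, fun m hm q => (h1 m hm q).2, h2⟩
  obtain ⟨ε, hε, hsub⟩ := mem_nhdsGT_iff_exists_Ioo_subset.1 (hsmall C b hC hb)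
  exact ⟨ε, hε, fun w hw hwε =>
    MarleBGK.exists_unique_mildSolution hnonneg hint ha hc ⟨_, hmem⟩ hG (hsub ⟨hw, hwε⟩)⟩
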